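/- Fix integers $3\le c<\Delta$ and a real $0<p<\tfrac12$. Let $H(x)=-x\log_2x-(1-x)\log_2(1-x)$ with $0\log_2 0=0$. **Setting.** Let $n\ge 1$ and $m$ be integers with $m\Delta=nc$. The label vector $\mathbf X\in\{0,1\}^n$ has i.i.d. $\mathrm{Ber}(p)$ entries. Take a random $(c,\Delta)$-biregular bipartite multigraph between $n$ left vertices (the elements) and $m$ right vertices (the XOR queries): give every left vertex $c$ half-edges and every right vertex $\Delta$ half-edges, and join the $nc$ left half-edges to the $m\Delta$ right half-edges by a uniformly random bijection. The query matrix $\mathbf Q\in\{0,1\}^{m\times n}$ is the incidence matrix of this graph: $\mathbf Q_{ji}=1$ if query $j$ and element $i$ are joined by at least one edge, and $\mathbf Q_{ji}=0$ otherwise. The answers to the queries are $\mathbf Q\mathbf X \bmod 2$. A vector $\mathbf x\in\{0,1\}^n$ is typical if its Hamming weight satisfies $|\mathrm{wt}(\mathbf x)-np|\le n^{2/3}$. A typical-set decoder $\Psi$ knows $\mathbf Q$ and, given an answer vector $\mathbf y$ for which some typical $\mathbf x$ satisfies $\mathbf Q\mathbf x=\mathbf y$ (mod 2), returns a typical vector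 $\hat{\mathbf x}$ with $\mathbf Q\hat{\mathbf x}=\mathbf y$; it is otherwise arbitrary. Its average error probability is $$P_e=\sum_{\mathbf x\in\{0,1\}^n}\Pr(\mathbf X=\mathbf x)\,\Pr_{\mathbf Q}\big(\Psi(\mathbf Q\mathbf x)\ne\mathbf x\big).$$ **Theorem.** Let $$\beta=\frac2\Delta\Big(\frac1{2\Delta^2p(1-p)e^{3c/2}}\Big)^{\frac1{c-2}},$$ and suppose that $$m>n\max_{\beta\le x\le 2p}\frac{pH\big(\frac{x}{2p}\big)+(1-p)H\big(\frac{x}{2(1-p)}\big)}{1-\log_2\big(1+(1-2x)^\Delta\big)},$$ where the maximum is read as $0$ if $\beta>2p$. Then the average error probability tends to zero, with $$P_e\le n^{2-c}(1-p+p^2)(\Delta c)^c(1+o(1)).$$ Here, and below, limits are taken as $n\to\infty$ along the pairs $(n,m)$ that satisfy $m\Delta=nc$ and the displayed condition, for fixed $c,\Delta,p$ and uniformly over all typical-set decoders. If, instead, parallel edges are counted modulo 2, that is, $\mathbf Q_{ji}$ is the parity of the number of edges joining $j$ and $i$, then under the same condition $P_e$ still tends to zero, and the same bound on $P_e$ holds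 whenever $c$ is odd. -/

import Mathlib

namespace XorQuery

/-- An outcome of the configuration model with `n` left vertices (elements) of degree `c` and `m`
right vertices (queries) of degree `Δ`: a bijection from the `n * c` half-edges on the left to the
`m * Δ` half-edges on the right, that is, a permutation of the half-edges once an ordering
is fixed on both sides. -/
abbrev Matching (n m c Δ : ℕ) : Type := Fin n × Fin c ≃ Fin m × Fin Δ

/-- Number of (parallel) edges joining query `j` to element `i`. -/
def edgeCount {n m c Δ : ℕ} (π : Matching n m c Δ) (j : Fin m) (i : Fin n) : ℕ :=
  (Finset.univ.filter fun a : Fin c => (π (i, a)).1 = j).card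

/-- The binary query matrix of the bipartite graph: the entry is `1` exactly when query `j`
involves element `i`, that is, when they are joined by at least one edge. -/
def incidenceMatrix {n m c Δ : ℕ} (π : Matching n m c Δ) : Matrix (Fin m) (Fin n) (ZMod 2) :=
  Matrix.of fun j i => if 0 < edgeCount π j i then 1 else 0

/-- The query matrix with parallel edges counted modulo 2: the label of `i` enters the XOR of
query `j` once for every edge between them. -/
def parityMatrix {n m c Δ : ℕ} (π : Matching n m c Δ) : Matrix (Fin m) (Fin n) (ZMod 2) :=
  Matrix.of fun j i => (edgeCount π j i : ZMod 2)

/-- Probability of the label vector `x` when the labels are i.i.d. Bernoulli(`p`). -/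
def labelProb {n : ℕ} (p : ℝ) (x : Fin n → ZMod 2) : ℝ :=
  ∏ i, if x i = 1 then p else 1 - p

/-- The typical set: Hamming weight within `n^(2/3)` of `n p`. -/
def IsTypical {n : ℕ} (p : ℝ) (x : Fin n → ZMod 2) : Prop :=
  |(hammingNorm x : ℝ) - n * p| ≤ (n : ℝ) ^ (2 / 3 : ℝ)

/-- A decoder knows the query matrix and maps query answers to a label vector. -/
abbrev Decoder (n m : ℕ) : Type :=
  Matrix (Fin m) (Fin n) (ZMod 2) → (Fin m → ZMod 2) → (Fin n → ZMod 2)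

/-- A typical-set decoder: it returns some typical label vector that is consistent with the
answers whenever there is one (nothing is asked of it otherwise). -/
def IsTypicalSetDecoder {n m : ℕ} (p : ℝ) (Ψ : Decoder n m) : Prop :=
  ∀ (Q : Matrix (Fin m) (Fin n) (ZMod 2)) (y : Fin m → ZMod 2),
    (∃ x : Fin n → ZMod 2, IsTypical p x ∧ Q.mulVec x = y) →
      IsTypical p (Ψ Q y) ∧ Q.mulVec (Ψ Q y) = y

open Classical in
/-- Average error probability `∑ x, P(x) * Pr_π (Ψ (Q x) ≠ x)`, where `π` is uniform among all
matchings and `Q = Qmat π`. -/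
noncomputable def errorProb {n m c Δ : ℕ} (p : ℝ)
    (Qmat : Matching n m c Δ → Matrix (Fin m) (Fin n) (ZMod 2)) (Ψ : Decoder n m) : ℝ :=
  ∑ x : Fin n → ZMod 2, labelProb p x *
    (((Finset.univ.filter fun π : Matching n m c Δ =>
        Ψ (Qmat π) ((Qmat π).mulVec x) ≠ x).card : ℝ) / (Fintype.card (Matching n m c Δ) : ℝ))

/-- Binary entropy in bits. -/
noncomputable def entropy2 (x : ℝ) : ℝ :=
  -x * Real.logb 2 x - (1 - x) * Real.logb 2 (1 - x)

noncomputable def beta (c Δ : ℕ) (p : ℝ) : ℝ :=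
  2 / Δ * (1 / (2 * (Δ : ℝ) ^ 2 * p * (1 - p) * Real.exp (3 * c / 2))) ^ (1 / ((c : ℝ) - 2))

/-- The function that is maximized to get the required number of queries per element. -/
noncomputable def ratio (Δ : ℕ) (p x : ℝ) : ℝ :=
  (p * entropy2 (x / (2 * p)) + (1 - p) * entropy2 (x / (2 * (1 - p)))) /
    (1 - Real.logb 2 (1 + (1 - 2 * x) ^ Δ))

/-- The maximum of `ratio` over `[β, 2p]`. The function is continuous on this compact interval
for `0 < p < 1/2`, so the supremum is attained; if `2p < β` the value is `0`. -/
noncomputable def threshold (c Δ : ℕ) (p : ℝ) : ℝ :=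
  sSup (ratio Δ p '' Set.Icc (beta c Δ p) (2 * p))

end XorQuery

/-! A typical-set decoder errs on a typical `x` only if some nonzero `d` with `x + d` typical
satisfies `Q d = 0`. Atypical labels have probability at most `2 exp(-n^(1/3)/4)`, so a union bound
over `d`, grouped by weight `w`, remains. For both query matrices `Q d = 0` implies
`EvenOrParallel`: every query sends an even number of edges into the support `S` of `d`, or is
joined to an element of `S` by parallel edges. This event does not depend on how parallel edges are
counted, and it is bounded in two ways.

Sparse bound (`uprob_evenOrParallel_le_exp`): no query has exactly one edge into `S`, so the `wc`
edges leaving `S` reach at most `wc/2` queries. This has probability at most `C(m,s)(s/m)^(wc)` with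
`s = ⌊wc/2⌋`. Weight 2 then contributes `(n²/2)(Δc/n)^c`, the main term, since `1/2 ≤ 1 - p + p²`.
Weights from 3 to a small multiple of `n` contribute `O(n^(-3(c/2-1)))`, which is `o(n^(2-c))`.

Dense bound (`uprob_evenOrParallel_le`): `K = ⌊νm⌋` queries with parallel edges are
superexponentially unlikely. Otherwise all but `K` queries are even, which costs about `evenProb
(w/n)^(m-K)`, as if half-edges were chosen independently with probability `w/n`.

For `w ≈ xn` the number of admissible `d` has exponential rate at most about `shiftEntropy p x`
(`card_typical_shift_le`, `exists_shiftRate_le`). For `x ≤ β` the sparse bound beats this count; `β`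
is chosen for that. For `β ≤ x ≤ 2p` the dense bound beats it, because `m/n = c/Δ` exceeds the
threshold. Compactness makes the exponential decay uniform in `x`.

A vector of weight one is never in the kernel of the incidence matrix, nor of the parity matrix for
odd `c`. For the parity matrix with even `c` the sparse bound gives a contribution of order
`n^(1-c/2)`, which still vanishes. -/

namespace XorQuery
open Finset

/-! ### Uniform probability on a finite set -/

section UniformProbability

variable {Ω : Type*} [Fintype Ω]

open Classical in
/-- Probability of the event `P` under the uniform distribution on `Ω`. -/
noncomputable def uprob (P : Ω → Prop) : ℝ :=
  ((univ.filter P).card : ℝ) / (Fintype.card Ω : ℝ)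

lemma uprob_eq (P : Ω → Prop) [DecidablePred P] :
    uprob P = ((univ.filter P).card : ℝ) / (Fintype.card Ω : ℝ) := by
  unfold uprob
  congr!

lemma uprob_nonneg (P : Ω → Prop) : 0 ≤ uprob P := by unfold uprob; positivity

lemma uprob_mono {P Q : Ω → Prop} (h : ∀ ω, P ω → Q ω) : uprob P ≤ uprob Q := by
  classical
  unfold uprob
  gcongr with ω
  exact h ω

lemma uprob_le_one (P : Ω → Prop) : uprob P ≤ 1 := by
  unfold uprob
  apply div_le_one_of_le₀ _ (by positivity)
  exact_mod_cast card_le_univ _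

lemma uprob_eq_zero {P : Ω → Prop} (h : ∀ ω, ¬ P ω) : uprob P = 0 := by
  simp [uprob, h]

lemma uprob_or_le (P Q : Ω → Prop) : uprob (fun ω => P ω ∨ Q ω) ≤ uprob P + uprob Q := by
  classical
  rw [uprob_eq, uprob_eq, uprob_eq, ← add_div]
  gcongr
  rw [filter_or]
  exact_mod_cast card_union_le _ _

lemma uprob_exists_le {ι : Type*} (s : Finset ι) (P : ι → Ω → Prop) :
    uprob (fun ω => ∃ i ∈ s, P i ω) ≤ ∑ i ∈ s, uprob (P i) := by
  classical
  simp_rw [uprob_eq]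
  rw [← sum_div]
  gcongr
  have : (univ.filter fun ω => ∃ i ∈ s, P i ω) ⊆ s.biUnion fun i => univ.filter (P i) := by
    intro ω
    simp
  exact_mod_cast (card_le_card this).trans card_biUnion_le

lemma uprob_equiv {Ω' : Type*} [Fintype Ω'] (e : Ω ≃ Ω') (P : Ω' → Prop) :
    uprob (fun ω => P (e ω)) = uprob P := by
  classical
  unfold uprob
  rw [Fintype.card_congr e]
  congr 2
  exact card_equiv e (by simp)

end UniformProbability

/-! ### Uniform random bijections -/

section RandomBijection

variable {α β R : Type*} [Fintype α] [Fintype β] [Fintype R] [DecidableEq α] [DecidableEq β]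

open Classical in
/-- At most `(|α| - |R|)!` bijections have prescribed values on a set of size `|R|`. -/
lemma card_equiv_extending_le (ι : R ↪ α) (f : R → β) :
    (univ.filter fun π : α ≃ β => ∀ r, π (ι r) = f r).card
      ≤ (Fintype.card α - Fintype.card R).factorial := by
  rcases (univ.filter fun π : α ≃ β => ∀ r, π (ι r) = f r).eq_empty_or_nonempty with h | ⟨π₀, h₀⟩
  · simp [h]
  simp only [mem_filter, mem_univ, true_and] at h₀
  have hc : Fintype.card {a : α // a ∉ Set.range ι} = Fintype.card α - Fintype.card R := by
    rw [Fintype.card_subtype_compl]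
    congr 1
    exact (Fintype.card_congr (Equiv.ofInjective ι ι.injective)).symm
  rw [← hc, ← Fintype.card_perm,
    Fintype.card_congr (Equiv.Perm.subtypeEquivSubtypePerm (fun a : α => a ∉ Set.range ι)),
    ← Fintype.card_coe]
  -- Following an extension by the inverse of the fixed extension `π₀` gives a permutation that
  -- fixes the range of `ι`, hence a permutation of its complement.
  refine Fintype.card_le_of_injective (fun π => ⟨π.1.trans π₀.symm, ?_⟩) ?_
  · rintro a ha
    obtain ⟨r, rfl⟩ := not_not.1 ha
    have := (mem_filter.1 π.2).2 r
    simp [this, ← h₀ r]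
  · intro π π' h
    have h1 : (π.1.trans π₀.symm) = (π'.1.trans π₀.symm) := congrArg Subtype.val h
    ext a
    have := congrArg (fun e : Equiv.Perm α => π₀ (e a)) h1
    simpa using this

/-- Union bound for the restriction of a uniform bijection. -/
lemma uprob_restrict_mem_le (hαβ : Fintype.card α = Fintype.card β) (ι : R ↪ α)
    (F : Finset (R → β)) :
    uprob (fun π : α ≃ β => (fun r => π (ι r)) ∈ F)
      ≤ F.card * ((Fintype.card α - Fintype.card R).factorial : ℝ)
          / ((Fintype.card α).factorial : ℝ) := by
  classical
  rw [uprob_eq, Fintype.card_equiv (Fintype.equivOfCardEq hαβ)]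
  gcongr
  have hsub : (univ.filter fun π : α ≃ β => (fun r => π (ι r)) ∈ F)
      ⊆ F.biUnion fun f => univ.filter fun π : α ≃ β => ∀ r, π (ι r) = f r := by
    intro π hπ
    simp only [mem_filter, mem_univ, true_and] at hπ
    simp only [mem_biUnion, mem_filter, mem_univ, true_and]
    exact ⟨_, hπ, fun r => rfl⟩
  have := (card_le_card hsub).trans
    (card_biUnion_le_card_mul _ _ _ fun f _ => card_equiv_extending_le ι f)
  exact_mod_cast this

/-- The image of a fixed set under a uniform bijection is uniform among the sets of its size. -/
lemma uprob_image_mem_le (hαβ : Fintype.card α = Fintype.card β) (A : Finset α)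
    (B : Finset (Finset β)) (hB : ∀ b ∈ B, b.card = A.card) :
    uprob (fun π : α ≃ β => A.map π.toEmbedding ∈ B)
      ≤ B.card / ((Fintype.card α).choose A.card : ℝ) := by
  classical
  -- The image of `A` is `b` only if the restriction to `A` is one of the `|A|!` injections into
  -- `b`.
  set F : Finset (A → β) := B.biUnion fun b =>
    univ.filter fun f : A → β => Function.Injective f ∧ ∀ a, f a ∈ b with hF
  have hFc : F.card ≤ B.card * A.card.factorial := by
    refine card_biUnion_le_card_mul _ _ _ fun b hb => ?_
    have h1 : A.card.factorial = Fintype.card (A ↪ b) := by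
      rw [Fintype.card_embedding_eq, Fintype.card_coe, Fintype.card_coe, hB b hb,
        Nat.descFactorial_self]
    rw [h1, ← Fintype.card_coe]
    refine Fintype.card_le_of_injective
      (fun f => ⟨fun a => ⟨f.1 a, (mem_filter.1 f.2).2.2 a⟩, fun a a' h => ?_⟩) ?_
    · exact (mem_filter.1 f.2).2.1 (congrArg Subtype.val h)
    · intro f g h
      ext a
      exact congrArg (fun e : A ↪ b => (e a : β)) h
  have h := uprob_restrict_mem_le hαβ (Function.Embedding.subtype (· ∈ A)) F
  refine (uprob_mono fun π hπ => ?_).trans (h.trans ?_)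
  · simp only [hF, mem_biUnion, mem_filter, mem_univ, true_and]
    refine ⟨_, hπ, ?_, ?_⟩
    · intro a a' h
      exact Subtype.ext (π.injective h)
    · intro a
      simp
  · rw [Fintype.card_coe]
    have hA : A.card ≤ Fintype.card α := card_le_univ A
    have hch := Nat.choose_mul_factorial_mul_factorial hA
    rw [div_le_div_iff₀ (by positivity) (by exact_mod_cast Nat.choose_pos hA), ← hch]
    push_cast
    have : (F.card : ℝ) ≤ B.card * A.card.factorial := by exact_mod_cast hFc
    calc (F.card : ℝ) * (Fintype.card α - A.card).factorial * (Fintype.card α).choose A.card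
        ≤ (B.card * A.card.factorial) * (Fintype.card α - A.card).factorial
            * (Fintype.card α).choose A.card := by gcongr
      _ = _ := by ring

end RandomBijection

/-! ### Binomial coefficient estimates -/

section Binomials

lemma descFactorial_mul_pow_le {a N : ℕ} (h : a ≤ N) (r : ℕ) :
    a.descFactorial r * N ^ r ≤ N.descFactorial r * a ^ r := by
  induction r with
  | zero => simp
  | succ r ih =>
    rw [Nat.descFactorial_succ, Nat.descFactorial_succ, pow_succ, pow_succ]
    have h2 : (a - r) * N ≤ (N - r) * a := by
      rw [Nat.sub_mul, Nat.sub_mul, mul_comm N a]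
      exact Nat.sub_le_sub_left (Nat.mul_le_mul_left r h) _
    calc (a - r) * a.descFactorial r * (N ^ r * N)
        = (a.descFactorial r * N ^ r) * ((a - r) * N) := by ring
      _ ≤ (N.descFactorial r * a ^ r) * ((N - r) * a) := Nat.mul_le_mul ih h2
      _ = _ := by ring

lemma choose_div_choose_le {a N r : ℕ} (h : a ≤ N) (hr : r ≤ N) :
    (a.choose r : ℝ) / (N.choose r : ℝ) ≤ ((a : ℝ) / N) ^ r := by
  have hpos : 0 < N.choose r := Nat.choose_pos hr
  rcases Nat.eq_zero_or_pos N with rfl | hN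
  · obtain rfl : r = 0 := by omega
    simp
  rw [div_pow, div_le_div_iff₀ (by exact_mod_cast hpos) (by positivity)]
  have h1 := descFactorial_mul_pow_le h r
  rw [Nat.descFactorial_eq_factorial_mul_choose, Nat.descFactorial_eq_factorial_mul_choose] at h1
  have h2 : r.factorial * (a.choose r * N ^ r) ≤ r.factorial * (a ^ r * N.choose r) := by
    calc _ = r.factorial * a.choose r * N ^ r := by ring
      _ ≤ _ := h1
      _ = _ := by ring
  exact_mod_cast Nat.le_of_mul_le_mul_left h2 (Nat.factorial_pos r)

lemma choose_mul_pow_le_pow {δ : ℝ} (hδ : 0 ≤ δ) (m k : ℕ) :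
    (m.choose k : ℝ) * δ ^ k ≤ (1 + δ) ^ m := by
  rcases lt_or_ge m k with h | h
  · rw [Nat.choose_eq_zero_of_lt h]
    simp only [Nat.cast_zero, zero_mul]
    positivity
  rw [add_comm, add_pow]
  have := single_le_sum (f := fun i => δ ^ i * 1 ^ (m - i) * (m.choose i : ℝ))
    (s := range (m + 1)) (fun i _ => by positivity) (mem_range.2 (Nat.lt_succ_of_le h))
  calc _ = δ ^ k * 1 ^ (m - k) * (m.choose k : ℝ) := by rw [one_pow]; ring
    _ ≤ _ := this

/-- The mode of the binomial distribution with parameters `N`, `r / N` is `r`. -/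
lemma choose_mul_pow_mul_pow_le_mode {N r k : ℕ} (hr : r ≤ N) (hk : k ≤ N) :
    N.choose k * r ^ k * (N - r) ^ (N - k) ≤ N.choose r * r ^ r * (N - r) ^ (N - r) := by
  have hpos : 0 < k.factorial * (N - k).factorial * (r.factorial * (N - r).factorial) := by
    positivity
  refine Nat.le_of_mul_le_mul_left ?_ hpos
  have h1 := Nat.choose_mul_factorial_mul_factorial hr
  have h2 := Nat.choose_mul_factorial_mul_factorial hk
  have e1 : k.factorial * (N - k).factorial * (r.factorial * (N - r).factorial)
      * (N.choose k * r ^ k * (N - r) ^ (N - k))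
      = N.factorial * (r.factorial * r ^ k * ((N - r).factorial * (N - r) ^ (N - k))) := by
    rw [← h2]; ring
  have e2 : k.factorial * (N - k).factorial * (r.factorial * (N - r).factorial)
      * (N.choose r * r ^ r * (N - r) ^ (N - r))
      = N.factorial * (k.factorial * r ^ r * ((N - k).factorial * (N - r) ^ (N - r))) := by
    rw [← h1]; ring
  rw [e1, e2]
  apply Nat.mul_le_mul_left
  -- Equivalently, `a^b / b!` is largest at `b = a`; the binomial mode follows from one such
  -- inequality for `r` and one for `N - r`.
  have key : ∀ a b : ℕ, a.factorial * a ^ b ≤ b.factorial * a ^ a := by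
    intro a b
    rcases le_total a b with h | h
    · calc a.factorial * a ^ b = (a.factorial * a ^ (b - a)) * a ^ a := by
            rw [mul_assoc, ← pow_add, Nat.sub_add_cancel h]
        _ ≤ _ := Nat.mul_le_mul_right _ (Nat.factorial_mul_pow_sub_le_factorial h)
    · have : a.factorial ≤ b.factorial * a ^ (a - b) := by
        have h3 := Nat.factorial_mul_descFactorial (n := a) (k := a - b) (by omega)
        rw [← h3, Nat.sub_sub_self h]
        exact Nat.mul_le_mul_left _ (Nat.descFactorial_le_pow _ _)
      calc a.factorial * a ^ b ≤ b.factorial * a ^ (a - b) * a ^ b :=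
            Nat.mul_le_mul_right _ this
        _ = _ := by rw [mul_assoc, ← pow_add, Nat.sub_add_cancel h]
  exact Nat.mul_le_mul (key r k) (key (N - r) (N - k))

/-- The `N + 1` binomial probabilities sum to one and the term at the mode is the largest. This is
the price of replacing a uniform set of size `r` by independent choices with probability `r / N`. -/
lemma one_le_choose_mul_pow_mul_pow {N r : ℕ} (hN : 0 < N) (hr : r ≤ N) :
    1 ≤ (N + 1) * (N.choose r * ((r : ℝ) / N) ^ r * (1 - (r : ℝ) / N) ^ (N - r)) := by
  have h0 : N ^ N ≤ (N + 1) * (N.choose r * r ^ r * (N - r) ^ (N - r)) := by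
    have h : N ^ N = (r + (N - r)) ^ N := by rw [Nat.add_sub_cancel' hr]
    rw [h, add_pow]
    refine (sum_le_card_nsmul _ _ (N.choose r * r ^ r * (N - r) ^ (N - r)) fun k hk => ?_).trans ?_
    · refine le_trans (le_of_eq ?_)
        (choose_mul_pow_mul_pow_le_mode hr (Nat.lt_succ_iff.1 (mem_range.1 hk)))
      simp only [Nat.cast_id]; ring
    · simp
  have h1 : (1 : ℝ) - r / N = ((N - r : ℕ) : ℝ) / N := by
    rw [Nat.cast_sub hr]; field_simp
  have hN' : (0 : ℝ) < (N : ℝ) ^ N := by positivity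
  rw [h1, div_pow, div_pow]
  have h2 : ((N : ℝ) ^ r) * (N : ℝ) ^ (N - r) = (N : ℝ) ^ N := by
    rw [← pow_add, Nat.add_sub_cancel' hr]
  have h3 : (N + 1) * (N.choose r * ((r : ℝ) ^ r / (N : ℝ) ^ r)
      * (((N - r : ℕ) : ℝ) ^ (N - r) / (N : ℝ) ^ (N - r)))
      = ((N + 1) * (N.choose r * (r : ℝ) ^ r * ((N - r : ℕ) : ℝ) ^ (N - r))) / (N : ℝ) ^ N := by
    rw [← h2]; field_simp
  rw [h3, le_div_iff₀ hN', one_mul]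
  exact_mod_cast h0

end Binomials

end XorQuery

namespace XorQuery
open Finset

/-! ### Edges and half-edges seen from a query -/

section Fibres

variable {n m c Δ : ℕ}

/-- Number of edges between query `j` and the elements in `S`. -/
def edgesFrom (π : Matching n m c Δ) (S : Finset (Fin n)) (j : Fin m) : ℕ :=
  ∑ i ∈ S, edgeCount π j i

/-- The half-edges of query `j` that belong to `B`. -/
def fibre (B : Finset (Fin m × Fin Δ)) (j : Fin m) : Finset (Fin Δ) :=
  univ.filter fun k => (j, k) ∈ B

/-- The half-edges on the right matched to the elements in `S`. -/
def halfEdgeImage (π : Matching n m c Δ) (S : Finset (Fin n)) : Finset (Fin m × Fin Δ) :=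
  (S ×ˢ (univ : Finset (Fin c))).map π.toEmbedding

lemma card_halfEdges (S : Finset (Fin n)) :
    (S ×ˢ (univ : Finset (Fin c))).card = S.card * c := by
  simp

lemma card_halfEdgeImage (π : Matching n m c Δ) (S : Finset (Fin n)) :
    (halfEdgeImage π S).card = S.card * c := by
  simp [halfEdgeImage]

lemma card_filter_fst_eq (B : Finset (Fin m × Fin Δ)) (j : Fin m) :
    (B.filter fun b => b.1 = j).card = (fibre B j).card := by
  refine card_bij' (fun b _ => b.2) (fun k _ => (j, k)) ?_ ?_ ?_ ?_
  · rintro ⟨a, b⟩ h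
    simp only [mem_filter, fibre, mem_univ, true_and] at h ⊢
    rw [← h.2]; exact h.1
  · intro k h
    simpa [fibre] using h
  · rintro ⟨a, b⟩ h
    simp only [mem_filter] at h
    simp [h.2]
  · simp

lemma card_eq_sum_card_fibre (B : Finset (Fin m × Fin Δ)) :
    B.card = ∑ j, (fibre B j).card := by
  simp_rw [← card_filter_fst_eq]
  exact card_eq_sum_card_fiberwise fun b _ => mem_coe.2 (mem_univ b.1)

lemma edgesFrom_eq (π : Matching n m c Δ) (S : Finset (Fin n)) (j : Fin m) :
    edgesFrom π S j = (fibre (halfEdgeImage π S) j).card := by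
  classical
  rw [← card_filter_fst_eq, halfEdgeImage, filter_map, card_map, edgesFrom]
  rw [card_eq_sum_card_fiberwise (f := Prod.fst) (t := S)]
  · refine sum_congr rfl fun i hi => ?_
    rw [edgeCount]
    refine card_bij' (fun a _ => (i, a)) (fun x _ => x.2) ?_ ?_ ?_ ?_
    · intro a ha
      simp only [mem_filter, mem_univ, true_and] at ha
      simp [hi, ha]
    · rintro ⟨i', a⟩ h
      simp only [mem_filter, mem_product, mem_univ, and_true, Function.comp_apply,
        Equiv.coe_toEmbedding] at h
      simp only [mem_filter, mem_univ, true_and]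
      rw [← h.2]; exact h.1.2
    · simp
    · rintro ⟨i', a⟩ h
      simp only [mem_filter] at h
      simp [h.2]
  · intro x hx
    simp only [coe_filter, mem_product, mem_univ, and_true, Set.mem_ofPred_eq] at hx
    exact hx.1

lemma sum_edgeCount (π : Matching n m c Δ) (i : Fin n) : ∑ j, edgeCount π j i = c := by
  have h := card_eq_sum_card_fibre (halfEdgeImage π {i})
  simp_rw [← edgesFrom_eq, card_halfEdgeImage] at h
  simpa [edgesFrom] using h.symm

lemma card_halfEdge_types (h : m * Δ = n * c) :
    Fintype.card (Fin n × Fin c) = Fintype.card (Fin m × Fin Δ) := by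
  simp [h]

end Fibres

/-! ### Sparse supports: few queries are touched -/

section FewTouchedQueries

variable {n m c Δ : ℕ}

/-- The matched half-edges form a uniform set of size `|S| c` among `mΔ`, and it must lie among the
`|T| Δ` half-edges of `T`; a ratio of binomials is at most the power of the density. -/
lemma uprob_edgesFrom_supported_le (hN : m * Δ = n * c) (hm : 0 < m) (hΔ : 0 < Δ)
    (S : Finset (Fin n)) (T : Finset (Fin m)) :
    uprob (fun π : Matching n m c Δ => ∀ b ∈ halfEdgeImage π S, b.1 ∈ T)
      ≤ ((T.card : ℝ) / m) ^ (S.card * c) := by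
  have hT : T.card ≤ m := by simpa using card_le_univ T
  have hS : S.card * c ≤ m * Δ := by
    rw [hN]; exact Nat.mul_le_mul_right c (by simpa using card_le_univ S)
  have h := uprob_image_mem_le (card_halfEdge_types hN) (S ×ˢ (univ : Finset (Fin c)))
    (powersetCard (S.card * c) (T ×ˢ (univ : Finset (Fin Δ)))) (fun b hb => by
      rw [(mem_powersetCard.1 hb).2, card_halfEdges])
  refine (uprob_mono fun π hπ => ?_).trans (h.trans ?_)
  · rw [mem_powersetCard]
    refine ⟨fun b hb => ?_, card_halfEdgeImage π S⟩
    rw [mem_product]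
    exact ⟨hπ b hb, mem_univ _⟩
  · rw [card_powersetCard, card_halfEdges, card_halfEdge_types hN]
    simp only [card_product, card_univ, Fintype.card_fin, Fintype.card_prod]
    refine (choose_div_choose_le (Nat.mul_le_mul_right Δ hT) hS).trans (le_of_eq ?_)
    congr 1
    push_cast
    field_simp

/-- If no query has exactly one edge into `S`, then at most half of `|S| c` queries are touched. -/
lemma uprob_edgesFrom_ne_one_le (hN : m * Δ = n * c) (hm : 0 < m) (hΔ : 0 < Δ)
    (S : Finset (Fin n)) (hs : S.card * c / 2 ≤ m) :
    uprob (fun π : Matching n m c Δ => ∀ j, edgesFrom π S j ≠ 1)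
      ≤ (m.choose (S.card * c / 2) : ℝ)
        * (((S.card * c / 2 : ℕ) : ℝ) / m) ^ (S.card * c) := by
  classical
  have h1 := uprob_exists_le (powersetCard (S.card * c / 2) (univ : Finset (Fin m)))
    (fun T (π : Matching n m c Δ) => ∀ b ∈ halfEdgeImage π S, b.1 ∈ T)
  refine (uprob_mono fun π hπ => ?_).trans (h1.trans ?_)
  -- A touched query has a positive number of edges, different from one, hence at least two.
  · have h2 : ((halfEdgeImage π S).image Prod.fst).card * 2 ≤ S.card * c := by
      rw [← card_halfEdgeImage (Δ := Δ) π S]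
      rw [card_eq_sum_card_image Prod.fst (halfEdgeImage π S), ← smul_eq_mul]
      refine card_nsmul_le_sum _ _ _ fun j hj => ?_
      rw [card_filter_fst_eq, ← edgesFrom_eq]
      have h3 : 0 < edgesFrom π S j := by
        rw [edgesFrom_eq, ← card_filter_fst_eq, card_pos]
        obtain ⟨b, hb, rfl⟩ := mem_image.1 hj
        exact ⟨b, by simp [hb]⟩
      have := hπ j
      omega
    obtain ⟨T, hT, -, hTc⟩ := exists_subsuperset_card_eq
      (subset_univ ((halfEdgeImage π S).image Prod.fst)) (n := S.card * c / 2)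
      (by omega) (by simpa using hs)
    refine ⟨T, by simp [mem_powersetCard, hTc], fun b hb => hT (mem_image_of_mem _ hb)⟩
  · refine (sum_le_card_nsmul _ _ ((((S.card * c / 2 : ℕ) : ℝ) / m) ^ (S.card * c))
      fun T hT => ?_).trans (le_of_eq ?_)
    · refine (uprob_edgesFrom_supported_le hN hm hΔ S T).trans (le_of_eq ?_)
      rw [(mem_powersetCard.1 hT).2]
    · simp

end FewTouchedQueries

/-! ### Dense supports: all but a few queries are even -/

section EvenQueries

variable {m Δ : ℕ}

lemma sum_pow_card (Δ : ℕ) (z : ℝ) : ∑ b : Finset (Fin Δ), z ^ b.card = (1 + z) ^ Δ := by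
  have := sum_pow_mul_eq_add_pow z 1 (univ : Finset (Fin Δ))
  simp only [powerset_univ, one_pow, mul_one, card_univ, Fintype.card_fin] at this
  rw [this, add_comm]

lemma sum_even_pow_card (Δ : ℕ) (z : ℝ) :
    ∑ b : Finset (Fin Δ), (if Even b.card then z ^ b.card else 0)
      = ((1 + z) ^ Δ + (1 - z) ^ Δ) / 2 := by
  have h2 : (1 - z) = 1 + (-z) := by ring
  rw [h2, ← sum_pow_card Δ z, ← sum_pow_card Δ (-z), ← sum_add_distrib, sum_div]
  refine sum_congr rfl fun b _ => ?_
  split_ifs with hb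
  · rw [hb.neg_pow]; ring
  · rw [(Nat.not_even_iff_odd.1 hb).neg_pow]; ring

lemma fibre_injective : Function.Injective (fibre : Finset (Fin m × Fin Δ) → _) := by
  intro B B' h
  ext ⟨j, k⟩
  have := congrArg (fun φ => k ∈ φ j) h
  simpa [fibre] using this

/-- Generating-function bound for the sets of half-edges that meet each query outside `T` in an
even number of half-edges. -/
lemma card_even_outside_mul_pow_le {z : ℝ} (hz : 0 ≤ z) (r : ℕ) (T : Finset (Fin m)) :
    (((powersetCard r (univ : Finset (Fin m × Fin Δ))).filter
      fun B => ∀ j ∉ T, Even (fibre B j).card).card : ℝ) * z ^ r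
      ≤ (((1 + z) ^ Δ + (1 - z) ^ Δ) / 2) ^ (m - T.card) * ((1 + z) ^ Δ) ^ T.card := by
  classical
  -- With the weight `z ^ |B|` in place, the constraint `|B| = r` can be dropped; what is left
  -- factorises over the queries.
  set g : Fin m → Finset (Fin Δ) → ℝ := fun j b =>
    if j ∈ T then z ^ b.card else if Even b.card then z ^ b.card else 0 with hg
  have hg0 : ∀ j b, 0 ≤ g j b := by
    intro j b
    simp only [hg]
    split_ifs <;> positivity
  set F := (powersetCard r (univ : Finset (Fin m × Fin Δ))).filter
      fun B => ∀ j ∉ T, Even (fibre B j).card with hF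
  have h1 : (F.card : ℝ) * z ^ r = ∑ B ∈ F, ∏ j, g j (fibre B j) := by
    rw [sum_congr rfl (g := fun _ => z ^ r), sum_const, nsmul_eq_mul]
    intro B hB
    simp only [hF, mem_filter, mem_powersetCard] at hB
    rw [← hB.1.2, card_eq_sum_card_fibre, ← prod_pow_eq_pow_sum]
    refine prod_congr rfl fun j _ => ?_
    simp only [hg]
    split_ifs with h h'
    · rfl
    · rfl
    · exact absurd (hB.2 j h) h'
  have h2 : ∑ B ∈ F, ∏ j, g j (fibre B j)
      ≤ ∑ φ : Fin m → Finset (Fin Δ), ∏ j, g j (φ j) := by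
    rw [← sum_image (f := fun φ : Fin m → Finset (Fin Δ) => ∏ j, g j (φ j)) (g := fibre) (s := F)
      (fun _ _ _ _ h => fibre_injective h)]
    exact sum_le_sum_of_subset_of_nonneg (subset_univ _)
      fun φ _ _ => prod_nonneg fun j _ => hg0 j _
  have h3 : ∑ φ : Fin m → Finset (Fin Δ), ∏ j, g j (φ j) = ∏ j, ∑ b, g j b := by
    rw [prod_univ_sum, Fintype.piFinset_univ]
  rw [h1]
  refine h2.trans (le_of_eq ?_)
  rw [h3, ← prod_sdiff (subset_univ T)]
  congr 1
  · rw [prod_congr rfl (g := fun _ => ((1 + z) ^ Δ + (1 - z) ^ Δ) / 2), prod_const,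
      card_sdiff_of_subset (subset_univ T), card_univ, Fintype.card_fin]
    intro j hj
    rw [← sum_even_pow_card]
    simp [hg, (mem_sdiff.1 hj).2]
  · rw [prod_congr rfl (g := fun _ => (1 + z) ^ Δ), prod_const]
    intro j hj
    rw [← sum_pow_card]
    simp [hg, hj]

/-- Probability that an even number of the `Δ` half-edges of a query is chosen when each one is
chosen independently with probability `y`. -/
noncomputable def evenProb (Δ : ℕ) (y : ℝ) : ℝ := (1 + (1 - 2 * y) ^ Δ) / 2

variable {n c : ℕ}

/-- If half-edges were chosen independently with probability `y = |S|/n`, the queries outside `T`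
would be even independently. Conditioning on exactly `r` chosen half-edges costs at most the factor
`nc + 1`, because `r` is the mode. -/
lemma uprob_even_outside_le (hN : m * Δ = n * c) (hc : 0 < c)
    (S : Finset (Fin n)) (hS : 0 < S.card) (hSn : S.card < n) (T : Finset (Fin m)) :
    uprob (fun π : Matching n m c Δ => ∀ j ∉ T, Even (edgesFrom π S j))
      ≤ (n * c + 1) * evenProb Δ ((S.card : ℝ) / n) ^ (m - T.card) := by
  classical
  set r := S.card * c with hr
  set y : ℝ := (S.card : ℝ) / n with hy
  have hn0 : (0 : ℝ) < n := by exact_mod_cast (by omega : 0 < n)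
  have hc0 : (0 : ℝ) < c := by exact_mod_cast hc
  have hy0 : 0 < y := by
    have : (0 : ℝ) < S.card := by exact_mod_cast hS
    positivity
  have hy1 : 0 < 1 - y := by
    rw [hy, sub_pos, div_lt_one hn0]
    exact_mod_cast hSn
  have hrN : r ≤ n * c := Nat.mul_le_mul_right c hSn.le
  have hyr : y = (r : ℝ) / ((n * c : ℕ) : ℝ) := by
    rw [hy, hr]; push_cast; field_simp
  have hT : T.card ≤ m := by simpa using card_le_univ T
  have hmode := one_le_choose_mul_pow_mul_pow (N := n * c) (r := r)
    (Nat.mul_pos (by omega) hc) hrN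
  rw [← hyr] at hmode
  set F := (powersetCard r (univ : Finset (Fin m × Fin Δ))).filter
      fun B => ∀ j ∉ T, Even (fibre B j).card with hF
  have h := uprob_image_mem_le (card_halfEdge_types hN) (S ×ˢ (univ : Finset (Fin c))) F
    (fun b hb => by
      rw [(mem_powersetCard.1 (mem_filter.1 hb).1).2, card_halfEdges])
  refine (uprob_mono fun π hπ => ?_).trans (h.trans ?_)
  · simp only [hF, mem_filter, mem_powersetCard]
    refine ⟨⟨subset_univ _, card_halfEdgeImage π S⟩, fun j hj => ?_⟩
    have := hπ j hj
    rwa [edgesFrom_eq] at this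
  rw [card_halfEdges, ← hr]
  simp only [Fintype.card_prod, Fintype.card_fin]
  -- The odds of `y`: multiplying by `(1 - y)^(nc)` turns `z^r` into the Bernoulli weight `y^r (1 -
  -- y)^(nc - r)`.
  have hgen := card_even_outside_mul_pow_le (m := m) (Δ := Δ) (z := y / (1 - y)) (by positivity) r T
  rw [← hF] at hgen
  have e1 : 1 + y / (1 - y) = 1 / (1 - y) := by field_simp; ring
  have e2 : 1 - y / (1 - y) = (1 - 2 * y) / (1 - y) := by field_simp; ring
  have e3 : ((1 / (1 - y)) ^ Δ + ((1 - 2 * y) / (1 - y)) ^ Δ) / 2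
      = (1 / (1 - y)) ^ Δ * evenProb Δ y := by
    rw [evenProb, div_pow, div_pow, one_pow]; ring
  rw [e1, e2, e3, mul_pow] at hgen
  have e4 : ((1 / (1 - y)) ^ Δ) ^ (m - T.card) * evenProb Δ y ^ (m - T.card)
      * ((1 / (1 - y)) ^ Δ) ^ T.card
      = (1 / (1 - y)) ^ (n * c) * evenProb Δ y ^ (m - T.card) := by
    rw [mul_right_comm, ← pow_add, Nat.sub_add_cancel hT, ← pow_mul, mul_comm Δ m, hN]
  rw [e4] at hgen
  have hch : (0 : ℝ) < ((n * c).choose r : ℝ) := by exact_mod_cast Nat.choose_pos hrN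
  rw [div_le_iff₀ hch]
  have h5 : (F.card : ℝ) * (y ^ r * (1 - y) ^ (n * c - r)) ≤ evenProb Δ y ^ (m - T.card) := by
    have : (1 - y) ^ (n * c) * ((F.card : ℝ) * (y / (1 - y)) ^ r)
        ≤ (1 - y) ^ (n * c) * ((1 / (1 - y)) ^ (n * c) * evenProb Δ y ^ (m - T.card)) :=
      mul_le_mul_of_nonneg_left hgen (by positivity)
    have e5 : (1 - y) ^ (n * c) * ((1 / (1 - y)) ^ (n * c) * evenProb Δ y ^ (m - T.card))
        = evenProb Δ y ^ (m - T.card) := by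
      rw [← mul_assoc, ← mul_pow, mul_one_div_cancel hy1.ne', one_pow, one_mul]
    have e6 : (1 - y) ^ (n * c) * ((F.card : ℝ) * (y / (1 - y)) ^ r)
        = (F.card : ℝ) * (y ^ r * (1 - y) ^ (n * c - r)) := by
      have : (1 - y) ^ (n * c) = (1 - y) ^ r * (1 - y) ^ (n * c - r) := by
        rw [← pow_add, Nat.add_sub_cancel' hrN]
      rw [this, div_pow]
      field_simp
    rwa [e5, e6] at this
  have hF0 : (0 : ℝ) ≤ F.card := by positivity
  push_cast at hmode
  calc (F.card : ℝ) = F.card * 1 := by ring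
    _ ≤ F.card * (((n : ℝ) * c + 1) * ((n * c).choose r * y ^ r * (1 - y) ^ (n * c - r))) :=
        mul_le_mul_of_nonneg_left hmode hF0
    _ = ((n : ℝ) * c + 1) * (F.card * (y ^ r * (1 - y) ^ (n * c - r))) * (n * c).choose r := by
        ring
    _ ≤ _ := by gcongr

end EvenQueries

end XorQuery

namespace XorQuery
open Finset

/-! ### Parallel edges -/

section ParallelEdges

variable {n m c Δ : ℕ}

/-- Query `j` is joined to some element by at least two edges. -/
def HasParallelEdges (π : Matching n m c Δ) (j : Fin m) : Prop := ∃ i, 2 ≤ edgeCount π j i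

lemma HasParallelEdges.exists_ne {π : Matching n m c Δ} {j : Fin m} (h : HasParallelEdges π j) :
    ∃ q : Fin Δ × Fin Δ, q.1 ≠ q.2 ∧ (π.symm (j, q.1)).1 = (π.symm (j, q.2)).1 := by
  obtain ⟨i, hi⟩ := h
  obtain ⟨a, ha, b, hb, hab⟩ := one_lt_card.1 (show 1 < _ from hi)
  simp only [mem_filter, mem_univ, true_and] at ha hb
  have ea : (j, (π (i, a)).2) = π (i, a) := by rw [← ha]
  have eb : (j, (π (i, b)).2) = π (i, b) := by rw [← hb]
  refine ⟨((π (i, a)).2, (π (i, b)).2), fun h => hab ?_, ?_⟩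
  · have h1 : π (i, a) = π (i, b) := by
      rw [← ea, ← eb]
      exact congrArg (Prod.mk j) h
    simpa using π.injective h1
  · simp only [ea, eb, Equiv.symm_apply_apply]

/-- In each query of `T` two prescribed half-edges must lead to the same element. The pairs use
distinct half-edges, so the inverse matching is prescribed on `2|T|` of them and each pair costs a
factor of order `1/n`. -/
lemma uprob_symm_pairs_le (hN : m * Δ = n * c) (T : Finset (Fin m)) (q : T → Fin Δ × Fin Δ)
    (hq : ∀ j, (q j).1 ≠ (q j).2) (hT : 4 * T.card ≤ n * c) (hpos : 0 < n * c) :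
    uprob (fun π : Matching n m c Δ =>
      ∀ j : T, (π.symm (j.1, (q j).1)).1 = (π.symm (j.1, (q j).2)).1)
      ≤ (4 * c / (n * c : ℝ)) ^ T.card := by
  classical
  set N := n * c with hNdef
  set K := T.card with hK
  let ι : T × Bool ↪ Fin m × Fin Δ :=
    ⟨fun x => (x.1.1, if x.2 then (q x.1).1 else (q x.1).2), by
      rintro ⟨j, b⟩ ⟨j', b'⟩ h
      simp only [Prod.mk.injEq] at h
      obtain ⟨h1, h2⟩ := h
      obtain rfl : j = j' := Subtype.ext h1
      have h3 := hq j
      cases b <;> cases b' <;> simp_all [eq_comm]⟩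
  set F : Finset (T × Bool → Fin n × Fin c) :=
    univ.filter fun f => ∀ j, (f (j, true)).1 = (f (j, false)).1 with hF
  -- For each query the first half-edge is free (`N` choices), and the second is one of the `c`
  -- half-edges of the same element.
  have hFc : F.card ≤ (N * c) ^ K := by
    have : (N * c) ^ K = Fintype.card (T → (Fin n × Fin c) × Fin c) := by
      simp [hK, hNdef]
    rw [this, ← Fintype.card_coe]
    refine Fintype.card_le_of_injective
      (fun f j => (f.1 (j, true), (f.1 (j, false)).2)) ?_
    rintro ⟨f, hf⟩ ⟨g, hg⟩ h
    simp only [hF, mem_filter, mem_univ, true_and] at hf hg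
    have h1 : ∀ j, f (j, true) = g (j, true) ∧ (f (j, false)).2 = (g (j, false)).2 := by
      intro j
      simpa using congrFun h j
    refine Subtype.ext (funext ?_)
    rintro ⟨j, b⟩
    cases b
    · refine Prod.ext ?_ (h1 j).2
      rw [← hf j, ← hg j, (h1 j).1]
    · exact (h1 j).1
  have hcard : Fintype.card (Fin m × Fin Δ) = N := by simp [hN]
  have h := uprob_restrict_mem_le (card_halfEdge_types hN).symm ι F
  have h2 : uprob (fun π : Matching n m c Δ =>
      ∀ j : T, (π.symm (j.1, (q j).1)).1 = (π.symm (j.1, (q j).2)).1)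
      ≤ uprob (fun σ : (Fin m × Fin Δ) ≃ (Fin n × Fin c) => (fun x => σ (ι x)) ∈ F) := by
    rw [← uprob_equiv (Ω := Matching n m c Δ)
      (⟨Equiv.symm, Equiv.symm, fun _ => rfl, fun _ => rfl⟩ : Matching n m c Δ ≃ _)]
    refine uprob_mono fun π hπ => ?_
    simp only [hF, mem_filter, mem_univ, true_and]
    intro j
    exact hπ j
  refine h2.trans (h.trans ?_)
  have hR : Fintype.card (T × Bool) = 2 * K := by simp [hK, mul_comm]
  rw [hR, hcard]
  -- Each of the `2K` factors of `N! / (N - 2K)!` is at least `N - 2K`, hence at least `N / 2`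
  -- because `4K ≤ N`.
  have hfac : (N - 2 * K).factorial * (N - 2 * K) ^ (2 * K) ≤ N.factorial := by
    have := Nat.factorial_mul_pow_sub_le_factorial (n := N - 2 * K) (m := N) (by omega)
    rwa [Nat.sub_sub_self (by omega)] at this
  have hN0 : (0 : ℝ) < N := by exact_mod_cast hpos
  have hhalf : (N : ℝ) / 2 ≤ ((N - 2 * K : ℕ) : ℝ) := by
    rw [Nat.cast_sub (by omega)]
    have : (4 : ℝ) * K ≤ N := by exact_mod_cast hT
    push_cast
    linarith
  have hfac' : ((N - 2 * K).factorial : ℝ) * ((N : ℝ) / 2) ^ (2 * K) ≤ N.factorial := by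
    refine le_trans ?_ (by exact_mod_cast hfac : (((N - 2 * K).factorial : ℝ)
      * ((N - 2 * K : ℕ) : ℝ) ^ (2 * K)) ≤ N.factorial)
    gcongr
  rw [div_le_iff₀ (by positivity)]
  have hFc' : (F.card : ℝ) ≤ ((N : ℝ) * c) ^ K := by exact_mod_cast hFc
  calc (F.card : ℝ) * (N - 2 * K).factorial
      ≤ ((N : ℝ) * c) ^ K * (N - 2 * K).factorial := by gcongr
    _ = (4 * c / (N : ℝ)) ^ K * ((N - 2 * K).factorial * ((N : ℝ) / 2) ^ (2 * K)) := by
        rw [pow_mul, mul_left_comm, ← mul_pow, mul_comm]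
        congr 2
        field_simp
        ring
    _ ≤ (4 * c / (N : ℝ)) ^ K * N.factorial := by gcongr
    _ = _ := by simp [hNdef]

lemma uprob_parallelEdges_le (hN : m * Δ = n * c) (T : Finset (Fin m))
    (hT : 4 * T.card ≤ n * c) (hpos : 0 < n * c) :
    uprob (fun π : Matching n m c Δ => ∀ j ∈ T, HasParallelEdges π j)
      ≤ (4 * (Δ : ℝ) ^ 2 * c / (n * c)) ^ T.card := by
  classical
  have h1 := uprob_exists_le
    (univ.filter fun q : T → Fin Δ × Fin Δ => ∀ j, (q j).1 ≠ (q j).2)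
    (fun q (π : Matching n m c Δ) =>
      ∀ j : T, (π.symm (j.1, (q j).1)).1 = (π.symm (j.1, (q j).2)).1)
  refine (uprob_mono fun π hπ => ?_).trans (h1.trans ?_)
  · choose q hq using fun j : T => (hπ j.1 j.2).exists_ne
    exact ⟨q, by simpa using fun j => (hq j).1, fun j => (hq j).2⟩
  · refine (sum_le_card_nsmul _ _ ((4 * c / (n * c : ℝ)) ^ T.card) fun q hq => ?_).trans ?_
    · exact uprob_symm_pairs_le hN T q (mem_filter.1 hq).2 hT hpos
    · rw [nsmul_eq_mul]
      have h2 : (univ.filter fun q : T → Fin Δ × Fin Δ => ∀ j, (q j).1 ≠ (q j).2).card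
          ≤ (Δ ^ 2) ^ T.card := by
        refine (card_le_univ _).trans (le_of_eq ?_)
        simp [pow_two]
      have h3 : ((univ.filter fun q : T → Fin Δ × Fin Δ => ∀ j, (q j).1 ≠ (q j).2).card : ℝ)
          ≤ ((Δ : ℝ) ^ 2) ^ T.card := by exact_mod_cast h2
      refine (mul_le_mul_of_nonneg_right h3 (by positivity)).trans (le_of_eq ?_)
      rw [← mul_pow]
      congr 1
      ring

/-- Each query is even with respect to `S`, or has parallel edges to some element of `S`. -/
def EvenOrParallel (π : Matching n m c Δ) (S : Finset (Fin n)) : Prop :=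
  ∀ j, Even (edgesFrom π S j) ∨ ∃ i ∈ S, 2 ≤ edgeCount π j i

lemma EvenOrParallel.edgesFrom_ne_one {π : Matching n m c Δ} {S : Finset (Fin n)}
    (h : EvenOrParallel π S) (j : Fin m) : edgesFrom π S j ≠ 1 := by
  intro h1
  rcases h j with h2 | ⟨i, hi, h2⟩
  · rw [h1] at h2
    exact absurd h2 (by decide)
  · have : edgeCount π j i ≤ edgesFrom π S j :=
      single_le_sum (f := fun i => edgeCount π j i) (fun _ _ => Nat.zero_le _) hi
    omega

/-- The number `K` separates two cases. If at least `K` queries have parallel edges, some `K` of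
them serve as `T`; otherwise a set `T` of size `K` contains all of them and every query outside `T`
is even. -/
lemma uprob_evenOrParallel_le (hN : m * Δ = n * c) (hc : 0 < c)
    (S : Finset (Fin n)) (hS : 0 < S.card) (hSn : S.card < n) (K : ℕ) (hK : K ≤ m)
    (hK4 : 4 * K ≤ n * c) :
    uprob (fun π : Matching n m c Δ => EvenOrParallel π S)
      ≤ m.choose K * ((n * c + 1) * evenProb Δ ((S.card : ℝ) / n) ^ (m - K)
          + (4 * (Δ : ℝ) ^ 2 * c / (n * c)) ^ K) := by
  classical
  have hpos : 0 < n * c := Nat.mul_pos (by omega) hc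
  have h1 := uprob_exists_le (powersetCard K (univ : Finset (Fin m)))
    (fun T (π : Matching n m c Δ) =>
      (∀ j ∉ T, Even (edgesFrom π S j)) ∨ ∀ j ∈ T, HasParallelEdges π j)
  refine (uprob_mono fun π hπ => ?_).trans (h1.trans ?_)
  · set U := univ.filter fun j => HasParallelEdges π j with hU
    rcases le_total K U.card with h | h
    · obtain ⟨T, hT, hTc⟩ := exists_subset_card_eq h
      exact ⟨T, by simp [mem_powersetCard, hTc], Or.inr fun j hj => (mem_filter.1 (hT hj)).2⟩
    · obtain ⟨T, hT, -, hTc⟩ := exists_subsuperset_card_eq (subset_univ U) h (by simpa using hK)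
      refine ⟨T, by simp [mem_powersetCard, hTc], Or.inl fun j hj => ?_⟩
      rcases hπ j with h2 | ⟨i, -, h2⟩
      · exact h2
      · exact absurd (hT (mem_filter.2 ⟨mem_univ _, i, h2⟩)) hj
  · refine (sum_le_card_nsmul _ _ ((n * c + 1) * evenProb Δ ((S.card : ℝ) / n) ^ (m - K)
          + (4 * (Δ : ℝ) ^ 2 * c / (n * c)) ^ K) fun T hT => ?_).trans (le_of_eq ?_)
    · have hTc := (mem_powersetCard.1 hT).2
      refine (uprob_or_le _ _).trans (add_le_add ?_ ?_)
      · rw [← hTc]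
        exact uprob_even_outside_le hN hc S hS hSn T
      · rw [← hTc]
        exact uprob_parallelEdges_le hN T (by omega) hpos
    · simp [mul_add]

end ParallelEdges

end XorQuery

namespace XorQuery
open Finset

/-! ### Kernel vectors of the two query matrices -/

section Support

variable {n m c Δ : ℕ}

/-- The set of nonzero coordinates. -/
def supp (d : Fin n → ZMod 2) : Finset (Fin n) := univ.filter fun i => d i ≠ 0

lemma card_supp (d : Fin n → ZMod 2) : (supp d).card = hammingNorm d := by
  rw [supp, hammingNorm]

lemma eq_zero_or_eq_one (a : ZMod 2) : a = 0 ∨ a = 1 := by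
  revert a; decide

lemma mulVec_eq_sum_supp (Q : Matrix (Fin m) (Fin n) (ZMod 2)) (d : Fin n → ZMod 2) (j : Fin m) :
    Q.mulVec d j = ∑ i ∈ supp d, Q j i := by
  rw [Matrix.mulVec, dotProduct, supp, sum_filter]
  refine sum_congr rfl fun i _ => ?_
  rcases eq_zero_or_eq_one (d i) with h | h <;> simp [h]

lemma evenOrParallel_of_parityMatrix_mulVec_eq_zero (π : Matching n m c Δ)
    (d : Fin n → ZMod 2) (h : (parityMatrix π).mulVec d = 0) : EvenOrParallel π (supp d) := by
  intro j
  left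
  have hj := congrFun h j
  rw [mulVec_eq_sum_supp] at hj
  rw [← ZMod.natCast_eq_zero_iff_even, edgesFrom]
  simpa [parityMatrix] using hj

/-- For a query without parallel edges into the support, every edge count there is 0 or 1 and equals
the matrix entry, so the row sum is the parity of the number of edges. -/
lemma evenOrParallel_of_incidenceMatrix_mulVec_eq_zero (π : Matching n m c Δ)
    (d : Fin n → ZMod 2) (h : (incidenceMatrix π).mulVec d = 0) : EvenOrParallel π (supp d) := by
  intro j
  by_contra! hcon
  obtain ⟨hodd, hsimple⟩ := hcon
  apply hodd
  have hj := congrFun h j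
  rw [mulVec_eq_sum_supp] at hj
  rw [← ZMod.natCast_eq_zero_iff_even, edgesFrom]
  push_cast
  refine Eq.trans (sum_congr rfl fun i hi => ?_) hj
  have := hsimple i hi
  interval_cases h' : edgeCount π j i <;> simp [incidenceMatrix, h']

lemma incidenceMatrix_mulVec_ne_zero (hc : 0 < c) (π : Matching n m c Δ) (d : Fin n → ZMod 2)
    (hd : hammingNorm d = 1) : (incidenceMatrix π).mulVec d ≠ 0 := by
  intro h
  rw [← card_supp, card_eq_one] at hd
  obtain ⟨i, hi⟩ := hd
  have h0 : ∀ j, edgeCount π j i = 0 := by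
    intro j
    have hj := congrFun h j
    rw [mulVec_eq_sum_supp, hi, sum_singleton] at hj
    by_contra h1
    simp [incidenceMatrix, Nat.pos_of_ne_zero h1] at hj
  have := sum_edgeCount π i
  simp only [h0, sum_const_zero] at this
  omega

/-- A kernel vector supported on one element would make all its edge counts even, but they add up to
`c`. -/
lemma parityMatrix_mulVec_ne_zero (hc : Odd c) (π : Matching n m c Δ) (d : Fin n → ZMod 2)
    (hd : hammingNorm d = 1) : (parityMatrix π).mulVec d ≠ 0 := by
  intro h
  rw [← card_supp, card_eq_one] at hd
  obtain ⟨i, hi⟩ := hd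
  have h0 : ∀ j, Even (edgeCount π j i) := by
    intro j
    have hj := congrFun h j
    rw [mulVec_eq_sum_supp, hi, sum_singleton] at hj
    rw [← ZMod.natCast_eq_zero_iff_even]
    simpa [parityMatrix] using hj
  have := sum_edgeCount π i
  rw [← this] at hc
  exact Nat.not_odd_iff_even.2 (even_sum _ fun j _ => h0 j) hc

end Support

/-! ### Typical labels and the number of typical shifts -/

section Labels

variable {n : ℕ} {p : ℝ}

lemma labelProb_nonneg (hp₀ : 0 ≤ p) (hp₁ : p ≤ 1) (x : Fin n → ZMod 2) : 0 ≤ labelProb p x := by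
  refine prod_nonneg fun i _ => ?_
  split_ifs <;> linarith

lemma sum_prod_coordinates (g : Fin n → ZMod 2 → ℝ) :
    ∑ x : Fin n → ZMod 2, ∏ i, g i (x i) = ∏ i, (g i 0 + g i 1) := by
  rw [← Fintype.piFinset_univ, ← prod_univ_sum]
  exact prod_congr rfl fun i _ => Fin.sum_univ_two (fun a : Fin 2 => g i a)

lemma sum_labelProb (p : ℝ) : ∑ x : Fin n → ZMod 2, labelProb p x = 1 := by
  simp only [labelProb]
  rw [sum_prod_coordinates fun _ a => if a = 1 then p else 1 - p]
  simp

/-- The real number `0` or `1` with the same parity. -/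
def bit (a : ZMod 2) : ℝ := if a = 1 then 1 else 0

@[simp] lemma bit_zero : bit 0 = 0 := by simp [bit]

@[simp] lemma bit_one : bit 1 = 1 := by simp [bit]

lemma hammingNorm_eq_sum_bit (x : Fin n → ZMod 2) : (hammingNorm x : ℝ) = ∑ i, bit (x i) := by
  rw [hammingNorm, card_filter]
  push_cast
  refine sum_congr rfl fun i _ => ?_
  rcases eq_zero_or_eq_one (x i) with h | h <;> simp [h]

lemma hammingNorm_le (x : Fin n → ZMod 2) : hammingNorm x ≤ n := by
  simpa using hammingNorm_le_card_fintype (x := x)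

/-- From `exp y ≤ 1 + y + y²` for `|y| ≤ 1`: the linear terms cancel and the quadratic ones add up
to `p(1-p)t²`. -/
lemma bernoulli_mgf_le (hp₀ : 0 ≤ p) (hp₁ : p ≤ 1) {t : ℝ} (ht : |t| ≤ 1) :
    (1 - p) * Real.exp (-t * p) + p * Real.exp (t * (1 - p)) ≤ Real.exp (t ^ 2) := by
  have key : ∀ y : ℝ, |y| ≤ 1 → Real.exp y ≤ 1 + y + y ^ 2 := by
    intro y hy
    have := (abs_le.1 (Real.abs_exp_sub_one_sub_id_le hy)).2
    linarith
  have h1 : |-t * p| ≤ 1 := by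
    rw [abs_mul, abs_neg, abs_of_nonneg hp₀]
    nlinarith [abs_nonneg t]
  have h2 : |t * (1 - p)| ≤ 1 := by
    rw [abs_mul, abs_of_nonneg (sub_nonneg.2 hp₁)]
    nlinarith [abs_nonneg t]
  have h3 := mul_le_mul_of_nonneg_left (key _ h1) (sub_nonneg.2 hp₁)
  have h4 := mul_le_mul_of_nonneg_left (key _ h2) hp₀
  have h5 := Real.add_one_le_exp (t ^ 2)
  have h6 : p * (1 - p) * t ^ 2 ≤ t ^ 2 := by
    have : p * (1 - p) ≤ 1 := by nlinarith
    nlinarith [sq_nonneg t]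
  nlinarith

lemma sum_labelProb_mul_exp_le (hp₀ : 0 ≤ p) (hp₁ : p ≤ 1) {t : ℝ} (ht : |t| ≤ 1) :
    ∑ x : Fin n → ZMod 2, labelProb p x * Real.exp (t * (hammingNorm x - n * p))
      ≤ Real.exp (n * t ^ 2) := by
  have h : ∀ x : Fin n → ZMod 2, labelProb p x * Real.exp (t * (hammingNorm x - n * p))
      = ∏ i, ((if x i = 1 then p else 1 - p) * Real.exp (t * (bit (x i) - p))) := by
    intro x
    rw [prod_mul_distrib, ← Real.exp_sum, ← mul_sum, sum_sub_distrib, ← hammingNorm_eq_sum_bit]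
    simp [labelProb]
  simp_rw [h]
  rw [sum_prod_coordinates fun _ a => (if a = 1 then p else 1 - p) * Real.exp (t * (bit a - p))]
  rw [prod_const, card_univ, Fintype.card_fin, Real.exp_nat_mul]
  refine pow_le_pow_left₀ ?_ ?_ _
  · have : (0 : ℝ) ≤ 1 - p := by linarith
    simp only [zero_ne_one, if_false, if_true]
    positivity
  · refine le_trans (le_of_eq ?_) (bernoulli_mgf_le hp₀ hp₁ ht)
    simp only [zero_ne_one, if_false, if_true, bit_zero, bit_one]
    ring_nf

open Classical in
/-- Probability that the label vector is not typical. -/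
noncomputable def atypicalProb (n : ℕ) (p : ℝ) : ℝ :=
  ∑ x ∈ univ.filter (fun x : Fin n → ZMod 2 => ¬ IsTypical p x), labelProb p x

lemma atypicalProb_le (hp₀ : 0 ≤ p) (hp₁ : p ≤ 1) (hn : 0 < n) :
    atypicalProb n p ≤ 2 * Real.exp (-(n : ℝ) ^ (1 / 3 : ℝ) / 4) := by
  classical
  have hn1 : (1 : ℝ) ≤ n := by exact_mod_cast hn
  have hn0 : (0 : ℝ) < n := by linarith
  set t : ℝ := (n : ℝ) ^ (-(1 / 3) : ℝ) / 2 with ht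
  have htpos : 0 < t := by positivity
  have ht1 : t ≤ 1 := by
    have : (n : ℝ) ^ (-(1 / 3) : ℝ) ≤ 1 := Real.rpow_le_one_of_one_le_of_nonpos hn1 (by norm_num)
    linarith
  have e1 : t * (n : ℝ) ^ (2 / 3 : ℝ) = (n : ℝ) ^ (1 / 3 : ℝ) / 2 := by
    rw [ht, div_mul_eq_mul_div, ← Real.rpow_add hn0]; norm_num
  have e2 : n * t ^ 2 = (n : ℝ) ^ (1 / 3 : ℝ) / 4 := by
    have : (n : ℝ) * ((n : ℝ) ^ (-(1 / 3) : ℝ)) ^ 2 = (n : ℝ) ^ (1 / 3 : ℝ) := by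
      rw [← Real.rpow_natCast, ← Real.rpow_mul hn0.le]
      nth_rewrite 1 [← Real.rpow_one (n : ℝ)]
      rw [← Real.rpow_add hn0]; norm_num
    rw [ht, div_pow, ← this]; ring
  have hpt : ∀ x : Fin n → ZMod 2, ¬ IsTypical p x →
      1 ≤ Real.exp (-(n : ℝ) ^ (1 / 3 : ℝ) / 2) *
        (Real.exp (t * (hammingNorm x - n * p)) + Real.exp (-t * (hammingNorm x - n * p))) := by
    intro x hx
    rw [IsTypical, not_le] at hx
    have h1 : Real.exp (t * |(hammingNorm x : ℝ) - n * p|)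
        ≤ Real.exp (t * (hammingNorm x - n * p)) + Real.exp (-t * (hammingNorm x - n * p)) := by
      rcases abs_cases ((hammingNorm x : ℝ) - n * p) with ⟨h, -⟩ | ⟨h, -⟩
      · rw [h]; linarith [Real.exp_pos (-t * (hammingNorm x - n * p))]
      · rw [h, mul_neg, ← neg_mul]; linarith [Real.exp_pos (t * (hammingNorm x - n * p))]
    calc (1 : ℝ) = Real.exp (-(n : ℝ) ^ (1 / 3 : ℝ) / 2)
          * Real.exp (t * (n : ℝ) ^ (2 / 3 : ℝ)) := by
            rw [e1, ← Real.exp_add]; simp [neg_div]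
      _ ≤ Real.exp (-(n : ℝ) ^ (1 / 3 : ℝ) / 2)
          * Real.exp (t * |(hammingNorm x : ℝ) - n * p|) := by gcongr
      _ ≤ _ := by gcongr
  have habs : |t| ≤ 1 := by rwa [abs_of_pos htpos]
  have habs' : |-t| ≤ 1 := by rwa [abs_neg]
  have hA := sum_labelProb_mul_exp_le (n := n) hp₀ hp₁ habs
  have hB := sum_labelProb_mul_exp_le (n := n) hp₀ hp₁ habs'
  rw [neg_sq] at hB
  rw [e2] at hA hB
  calc atypicalProb n p
      ≤ ∑ x ∈ univ.filter (fun x : Fin n → ZMod 2 => ¬ IsTypical p x), labelProb p x *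
        (Real.exp (-(n : ℝ) ^ (1 / 3 : ℝ) / 2) *
        (Real.exp (t * (hammingNorm x - n * p)) + Real.exp (-t * (hammingNorm x - n * p)))) := by
        refine sum_le_sum fun x hx => ?_
        exact le_mul_of_one_le_right (labelProb_nonneg hp₀ hp₁ x) (hpt x (mem_filter.1 hx).2)
    _ ≤ ∑ x : Fin n → ZMod 2, labelProb p x *
        (Real.exp (-(n : ℝ) ^ (1 / 3 : ℝ) / 2) *
        (Real.exp (t * (hammingNorm x - n * p)) + Real.exp (-t * (hammingNorm x - n * p)))) := by
        refine sum_le_sum_of_subset_of_nonneg (subset_univ _) fun x _ _ => ?_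
        exact mul_nonneg (labelProb_nonneg hp₀ hp₁ x) (by positivity)
    _ = Real.exp (-(n : ℝ) ^ (1 / 3 : ℝ) / 2) *
        (∑ x : Fin n → ZMod 2, labelProb p x * Real.exp (t * (hammingNorm x - n * p))
        + ∑ x : Fin n → ZMod 2, labelProb p x * Real.exp (-t * (hammingNorm x - n * p))) := by
        rw [← sum_add_distrib, mul_sum]
        exact sum_congr rfl fun x _ => by ring
    _ ≤ Real.exp (-(n : ℝ) ^ (1 / 3 : ℝ) / 2) *
        (Real.exp ((n : ℝ) ^ (1 / 3 : ℝ) / 4) + Real.exp ((n : ℝ) ^ (1 / 3 : ℝ) / 4)) := by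
        gcongr
    _ = _ := by
        rw [← two_mul, mul_left_comm, ← Real.exp_add]
        ring_nf

open Classical in
/-- The number of vectors of weight `w` whose sum with a typical vector is typical. -/
lemma card_typical_shift_le {s t : ℝ} (hs : 0 < s) (ht : 0 < t) (x : Fin n → ZMod 2)
    (hx : IsTypical p x) (w : ℕ) :
    ((univ.filter fun d : Fin n → ZMod 2 => hammingNorm d = w ∧ IsTypical p (x + d)).card : ℝ)
      ≤ Real.exp (n * (p * Real.log (1 + s) + (1 - p) * Real.log (1 + t))
          - w / 2 * (Real.log s + Real.log t)
          + (|Real.log s - Real.log t| + |Real.log (1 + s) - Real.log (1 + t)|)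
            * (n : ℝ) ^ (2 / 3 : ℝ)) := by
  set D := univ.filter fun d : Fin n → ZMod 2 => hammingNorm d = w ∧ IsTypical p (x + d) with hD
  set e : ℝ := (n : ℝ) ^ (2 / 3 : ℝ) with he
  -- Chernoff count with two parameters: flipping a one of `x` has weight `s`, flipping a zero has
  -- weight `t`.
  set ℓ : Fin n → ℝ := fun i => bit (x i) * Real.log s + (1 - bit (x i)) * Real.log t with hℓ
  have hexpℓ : ∀ i, Real.exp (ℓ i) = if x i = 1 then s else t := by
    intro i
    rcases eq_zero_or_eq_one (x i) with h | h <;> simp [hℓ, h, Real.exp_log, hs, ht]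
  have hlow : ∀ d ∈ D, Real.exp (w / 2 * (Real.log s + Real.log t)
      - |Real.log s - Real.log t| * e) ≤ ∏ i, Real.exp (bit (d i) * ℓ i) := by
    intro d hd
    obtain ⟨hdw, hdt⟩ := (mem_filter.1 hd).2
    rw [← Real.exp_sum]
    apply Real.exp_le_exp.2
    -- If `d` flips `a` ones and `b` zeros, then `a + b = w` and `a - b = wt(x) - wt(x + d)`.
    -- Typicality of both vectors makes the difference at most `2 n^(2/3)`, so the total weight is
    -- close to `(st)^(w/2)`.
    have h1 : ∑ i, bit (d i) * ℓ i
        = (w : ℝ) / 2 * (Real.log s + Real.log t)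
          + ((hammingNorm x : ℝ) - hammingNorm (x + d)) * (Real.log s - Real.log t) / 2 := by
      rw [← hdw, hammingNorm_eq_sum_bit, hammingNorm_eq_sum_bit, hammingNorm_eq_sum_bit,
        ← sum_sub_distrib, sum_div, sum_mul, sum_mul, sum_div, ← sum_add_distrib]
      refine sum_congr rfl fun i _ => ?_
      have h11 : (1 + 1 : ZMod 2) = 0 := by decide
      rcases eq_zero_or_eq_one (x i) with h | h <;> rcases eq_zero_or_eq_one (d i) with h' | h' <;>
        simp [hℓ, h, h', h11] <;> ring
    rw [h1]
    have h2 : |(hammingNorm x : ℝ) - hammingNorm (x + d)| ≤ 2 * e := by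
      have a1 := abs_le.1 hx
      have a2 := abs_le.1 hdt
      rw [abs_le]
      constructor <;> linarith [a1.1, a1.2, a2.1, a2.2]
    have h3 : |((hammingNorm x : ℝ) - hammingNorm (x + d)) * (Real.log s - Real.log t)|
        ≤ 2 * e * |Real.log s - Real.log t| := by
      rw [abs_mul]
      exact mul_le_mul_of_nonneg_right h2 (abs_nonneg _)
    have h4 := (abs_le.1 h3).1
    linarith
  have hsum : ∑ d : Fin n → ZMod 2, ∏ i, Real.exp (bit (d i) * ℓ i)
      ≤ Real.exp (n * (p * Real.log (1 + s) + (1 - p) * Real.log (1 + t))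
        + |Real.log (1 + s) - Real.log (1 + t)| * e) := by
    rw [sum_prod_coordinates fun i a => Real.exp (bit a * ℓ i)]
    have h1 : ∏ i, (Real.exp (bit 0 * ℓ i) + Real.exp (bit 1 * ℓ i))
        = Real.exp (∑ i, (bit (x i) * Real.log (1 + s) + (1 - bit (x i)) * Real.log (1 + t))) := by
      rw [Real.exp_sum]
      refine prod_congr rfl fun i _ => ?_
      rw [bit_zero, bit_one, one_mul, zero_mul, Real.exp_zero, hexpℓ]
      have hs1 : 0 < 1 + s := by linarith
      have ht1 : 0 < 1 + t := by linarith
      rcases eq_zero_or_eq_one (x i) with h | h <;> simp [h, Real.exp_log, hs1, ht1]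
    rw [h1]
    apply Real.exp_le_exp.2
    have h2 : ∑ i, (bit (x i) * Real.log (1 + s) + (1 - bit (x i)) * Real.log (1 + t))
        = n * (p * Real.log (1 + s) + (1 - p) * Real.log (1 + t))
          + ((hammingNorm x : ℝ) - n * p) * (Real.log (1 + s) - Real.log (1 + t)) := by
      rw [sum_add_distrib, ← sum_mul, ← sum_mul, sum_sub_distrib, ← hammingNorm_eq_sum_bit]
      simp only [sum_const, card_univ, Fintype.card_fin, nsmul_eq_mul, mul_one]
      ring
    have h3 : |((hammingNorm x : ℝ) - n * p) * (Real.log (1 + s) - Real.log (1 + t))|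
        ≤ e * |Real.log (1 + s) - Real.log (1 + t)| := by
      rw [abs_mul]
      exact mul_le_mul_of_nonneg_right hx (abs_nonneg _)
    have h4 := (abs_le.1 h3).2
    rw [h2]
    linarith
  have h5 : (D.card : ℝ) * Real.exp (w / 2 * (Real.log s + Real.log t)
      - |Real.log s - Real.log t| * e)
      ≤ ∑ d : Fin n → ZMod 2, ∏ i, Real.exp (bit (d i) * ℓ i) := by
    rw [← nsmul_eq_mul]
    refine (card_nsmul_le_sum D _ _ hlow).trans ?_
    exact sum_le_sum_of_subset_of_nonneg (subset_univ _)
      fun d _ _ => prod_nonneg fun i _ => (Real.exp_pos _).le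
  have h6 := h5.trans hsum
  rw [← le_div_iff₀ (Real.exp_pos _), ← Real.exp_sub] at h6
  refine h6.trans (Real.exp_le_exp.2 (le_of_eq ?_))
  ring

lemma hammingNorm_le_of_typical {x d : Fin n → ZMod 2} (hx : IsTypical p x)
    (hd : IsTypical p (x + d)) : (hammingNorm d : ℝ) ≤ 2 * (n * p + (n : ℝ) ^ (2 / 3 : ℝ)) := by
  have h : hammingNorm d ≤ hammingNorm x + hammingNorm (x + d) := by
    have h1 := hammingDist_triangle x 0 (x + d)
    rw [hammingDist_zero_right, hammingDist_zero_left, hammingDist_eq_hammingNorm] at h1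
    refine le_trans (le_of_eq ?_) h1
    rw [neg_add_cancel_left]
  have h' : (hammingNorm d : ℝ) ≤ hammingNorm x + hammingNorm (x + d) := by exact_mod_cast h
  have a1 := (abs_le.1 hx).2
  have a2 := (abs_le.1 hd).2
  linarith

lemma card_hammingNorm_eq (n w : ℕ) :
    (univ.filter fun d : Fin n → ZMod 2 => hammingNorm d = w).card = n.choose w := by
  rw [← Finset.card_fin n, ← card_powersetCard, Finset.card_fin]
  refine card_bij' (fun d _ => supp d) (fun S _ i => if i ∈ S then 1 else 0) ?_ ?_ ?_ ?_
  · intro d hd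
    simpa [mem_powersetCard, card_supp] using hd
  · intro S hS
    simp only [mem_powersetCard, subset_univ, true_and] at hS
    simp [hammingNorm, hS]
  · intro d _
    ext i
    rcases eq_zero_or_eq_one (d i) with h | h <;> simp [supp, h]
  · intro S _
    ext i
    simp [supp]

end Labels

/-! ### From decoding errors to kernel vectors -/

section Decoding

variable {n m c Δ : ℕ} {p : ℝ}

open Classical in
/-- The nonzero differences between the vector `x` and a typical vector. -/
noncomputable def typicalShifts (p : ℝ) (x : Fin n → ZMod 2) : Finset (Fin n → ZMod 2) :=
  univ.filter fun d => d ≠ 0 ∧ IsTypical p (x + d)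

lemma uprob_decoding_error_le (Qmat : Matching n m c Δ → Matrix (Fin m) (Fin n) (ZMod 2))
    (Ψ : Decoder n m) (hΨ : IsTypicalSetDecoder p Ψ) (x : Fin n → ZMod 2) (hx : IsTypical p x) :
    uprob (fun π => Ψ (Qmat π) ((Qmat π).mulVec x) ≠ x)
      ≤ ∑ d ∈ typicalShifts p x, uprob fun π => (Qmat π).mulVec d = 0 := by
  refine (uprob_mono fun π hπ => ?_).trans (uprob_exists_le (typicalShifts p x) _)
  obtain ⟨h1, h2⟩ := hΨ (Qmat π) ((Qmat π).mulVec x) ⟨x, hx, rfl⟩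
  refine ⟨Ψ (Qmat π) ((Qmat π).mulVec x) - x, ?_, ?_⟩
  · simp only [typicalShifts, mem_filter, mem_univ, true_and]
    exact ⟨sub_ne_zero.2 hπ, by rwa [add_sub_cancel]⟩
  · rw [Matrix.mulVec_sub, h2, sub_self]

lemma errorProb_le (hp₀ : 0 ≤ p) (hp₁ : p ≤ 1)
    (Qmat : Matching n m c Δ → Matrix (Fin m) (Fin n) (ZMod 2))
    (Ψ : Decoder n m) (hΨ : IsTypicalSetDecoder p Ψ) {R : ℝ} (hR0 : 0 ≤ R)
    (hR : ∀ x : Fin n → ZMod 2, IsTypical p x →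
      ∑ d ∈ typicalShifts p x, uprob (fun π => (Qmat π).mulVec d = 0) ≤ R) :
    errorProb p Qmat Ψ ≤ atypicalProb n p + R := by
  classical
  have h0 : errorProb p Qmat Ψ = ∑ x : Fin n → ZMod 2, labelProb p x *
      uprob (fun π => Ψ (Qmat π) ((Qmat π).mulVec x) ≠ x) := by
    unfold errorProb
    simp_rw [uprob_eq]
  rw [h0, ← sum_filter_not_add_sum_filter univ (fun x : Fin n → ZMod 2 => IsTypical p x)]
  refine add_le_add ?_ ?_
  · rw [atypicalProb]
    refine le_trans (sum_le_sum fun x _ =>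
      mul_le_of_le_one_right (labelProb_nonneg hp₀ hp₁ x) (uprob_le_one _)) (le_of_eq ?_)
    congr!
  · calc ∑ x ∈ univ.filter (fun x : Fin n → ZMod 2 => IsTypical p x), labelProb p x *
          uprob (fun π => Ψ (Qmat π) ((Qmat π).mulVec x) ≠ x)
        ≤ ∑ x ∈ univ.filter (fun x : Fin n → ZMod 2 => IsTypical p x), labelProb p x * R := by
          refine sum_le_sum fun x hx => mul_le_mul_of_nonneg_left ?_ (labelProb_nonneg hp₀ hp₁ x)
          have hx := (mem_filter.1 hx).2
          exact (uprob_decoding_error_le Qmat Ψ hΨ x hx).trans (hR x hx)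
      _ ≤ ∑ x : Fin n → ZMod 2, labelProb p x * R :=
          sum_le_sum_of_subset_of_nonneg (subset_univ _)
            fun x _ _ => mul_nonneg (labelProb_nonneg hp₀ hp₁ x) hR0
      _ = R := by rw [← sum_mul, sum_labelProb, one_mul]

end Decoding

end XorQuery

namespace XorQuery
open Finset

/-! ### Union bound for small weights -/

section SmallWeights

variable {n m c Δ : ℕ}

lemma choose_le_exp {N k : ℕ} (hk : 0 < k) (hN : 0 < N) :
    (N.choose k : ℝ) ≤ Real.exp (k * (1 - Real.log (k / N))) := by
  have hk0 : (0 : ℝ) < k := by exact_mod_cast hk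
  have hN0 : (0 : ℝ) < N := by exact_mod_cast hN
  have h1 : (N.choose k : ℝ) ≤ (N : ℝ) ^ k / k.factorial := Nat.choose_le_pow_div k N
  have h2 := Real.pow_div_factorial_le_exp (k : ℝ) hk0.le k
  have h3 : Real.exp (k * (1 - Real.log (k / N))) = Real.exp k * ((N : ℝ) / k) ^ k := by
    rw [mul_sub, mul_one, sub_eq_add_neg, Real.exp_add, ← mul_neg, ← Real.log_inv, inv_div,
      ← Real.log_pow, Real.exp_log (by positivity)]
  rw [h3]
  calc (N.choose k : ℝ) ≤ (N : ℝ) ^ k / k.factorial := h1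
    _ = ((k : ℝ) ^ k / k.factorial) * ((N : ℝ) / k) ^ k := by
        rw [div_pow]; field_simp
    _ ≤ _ := by gcongr

lemma query_ratio_eq (hN : m * Δ = n * c) (hm : 0 < m) (hn : 0 < n) (w : ℕ) :
    (w : ℝ) * c / 2 / m = Δ / 2 * (w / n) := by
  have h : (m : ℝ) * Δ = n * c := by exact_mod_cast hN
  have hm0 : (0 : ℝ) < m := by exact_mod_cast hm
  have hn0 : (0 : ℝ) < n := by exact_mod_cast hn
  field_simp
  linear_combination (-(w : ℝ)) * h

/-- Closed form of the sparse bound, without the floor in `wc/2`, so that it can be compared with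
the count of vectors of weight `w`. -/
lemma uprob_evenOrParallel_le_exp (hN : m * Δ = n * c) (hm : 0 < m) (hn : 0 < n) (hc : 2 ≤ c)
    (S : Finset (Fin n)) (hS : 0 < S.card) :
    uprob (fun π : Matching n m c Δ => EvenOrParallel π S)
      ≤ Real.exp (S.card * (c / 2) * (1 + Real.log (Δ / 2 * (S.card / n)))) := by
  set w := S.card with hw
  have hm0 : (0 : ℝ) < m := by exact_mod_cast hm
  have hΔ : 0 < Δ := by
    rcases Nat.eq_zero_or_pos Δ with h | h
    · rw [h, mul_zero] at hN
      have : 0 < n * c := by positivity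
      omega
    · exact h
  rw [← query_ratio_eq hN hm hn]
  -- If `wc/2` exceeds the number of queries, the exponent is nonnegative and the bound is trivial.
  rcases lt_or_ge m (w * c / 2) with h | h
  · refine (uprob_le_one _).trans (Real.one_le_exp ?_)
    have h1 : (m : ℝ) ≤ (w : ℝ) * c / 2 := by
      have : m * 2 ≤ w * c := by omega
      have : (m : ℝ) * 2 ≤ (w : ℝ) * c := by exact_mod_cast this
      linarith
    have h2 : 0 ≤ Real.log ((w : ℝ) * c / 2 / m) :=
      Real.log_nonneg (by rwa [le_div_iff₀ hm0, one_mul])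
    positivity
  · have h0 := (uprob_mono fun π (hπ : EvenOrParallel π S) => hπ.edgesFrom_ne_one).trans
      (uprob_edgesFrom_ne_one_le hN hm hΔ S h)
    rw [← hw] at h0
    set s := w * c / 2 with hs
    have hwc : 1 * 2 ≤ w * c := Nat.mul_le_mul hS hc
    have hs1 : 0 < s := by omega
    have hs0 : (0 : ℝ) < s := by exact_mod_cast hs1
    have hsw : (s : ℝ) ≤ (w : ℝ) * c / 2 := by
      have : s * 2 ≤ w * c := by omega
      have : (s : ℝ) * 2 ≤ (w : ℝ) * c := by exact_mod_cast this
      linarith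
    have hlog : Real.log ((s : ℝ) / m) ≤ 0 :=
      Real.log_nonpos (by positivity) (by rw [div_le_one hm0]; exact_mod_cast h)
    have hlog2 : Real.log ((s : ℝ) / m) ≤ Real.log ((w : ℝ) * c / 2 / m) :=
      Real.log_le_log (by positivity) (by gcongr)
    refine h0.trans ?_
    have h4 : ((s : ℝ) / m) ^ (w * c) = Real.exp ((w * c) * Real.log ((s : ℝ) / m)) := by
      rw [← Nat.cast_mul, ← Real.log_pow, Real.exp_log (by positivity)]
    rw [h4]
    refine (mul_le_mul_of_nonneg_right (choose_le_exp hs1 hm) (Real.exp_pos _).le).trans ?_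
    rw [← Real.exp_add]
    apply Real.exp_le_exp.2
    have e1 : (s : ℝ) * (1 - Real.log (s / m)) + w * c * Real.log (s / m)
        = s + (w * c - s) * Real.log (s / m) := by ring
    rw [e1]
    have e2 : ((w : ℝ) * c - s) * Real.log (s / m) ≤ (w * c / 2) * Real.log (s / m) :=
      mul_le_mul_of_nonpos_right (by linarith) hlog
    have e3 : ((w : ℝ) * c / 2) * Real.log (s / m)
        ≤ (w * c / 2) * Real.log ((w : ℝ) * c / 2 / m) :=
      mul_le_mul_of_nonneg_left hlog2 (by positivity)
    nlinarith

lemma uprob_evenOrParallel_pair_le (hN : m * Δ = n * c) (hm : 0 < m) (hn : 0 < n) (hc : 0 < c)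
    (S : Finset (Fin n)) (hS : S.card = 2) :
    uprob (fun π : Matching n m c Δ => EvenOrParallel π S) ≤ ((Δ : ℝ) * c / n) ^ c := by
  have hm0 : (0 : ℝ) < m := by exact_mod_cast hm
  have hn0 : (0 : ℝ) < n := by exact_mod_cast hn
  have hc0 : (0 : ℝ) < c := by exact_mod_cast hc
  have h : (m : ℝ) * Δ = n * c := by exact_mod_cast hN
  have hΔ : 0 < Δ := by
    rcases Nat.eq_zero_or_pos Δ with h | h
    · rw [h, mul_zero] at hN
      have : 0 < n * c := by positivity
      omega
    · exact h
  have e : (Δ : ℝ) * c / n = (c : ℝ) * c / m := by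
    field_simp
    linarith
  rw [e]
  have h2 : S.card * c / 2 = c := by rw [hS]; omega
  rcases lt_or_ge m c with hlt | hge
  · refine (uprob_le_one _).trans (one_le_pow₀ ?_)
    rw [le_div_iff₀ hm0, one_mul]
    have h3 : m ≤ c * c := hlt.le.trans (Nat.le_mul_of_pos_left c hc)
    exact_mod_cast h3
  · have h0 := (uprob_mono fun π (hπ : EvenOrParallel π S) => hπ.edgesFrom_ne_one).trans
      (uprob_edgesFrom_ne_one_le hN hm hΔ S (by rw [h2]; exact hge))
    rw [h2, hS] at h0
    refine h0.trans ?_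
    have h3 : (m.choose c : ℝ) ≤ (m : ℝ) ^ c := by exact_mod_cast Nat.choose_le_pow m c
    refine (mul_le_mul_of_nonneg_right h3 (by positivity)).trans (le_of_eq ?_)
    rw [pow_mul, ← mul_pow]
    congr 1
    field_simp

/-- The union bound over vectors of weight `w` at most a small multiple of `n`. -/
lemma exists_small_weight_bound (c Δ : ℕ) (hc : 3 ≤ c) (hΔ : 0 < Δ) :
    ∃ ε C : ℝ, 0 < ε ∧ 0 ≤ C ∧ ∀ n w : ℕ, 0 < n → 3 ≤ w → (w : ℝ) ≤ ε * n →
      (n.choose w : ℝ) * Real.exp (w * (c / 2) * (1 + Real.log (Δ / 2 * (w / n))))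
        ≤ (n : ℝ) ^ (-(3 * ((c : ℝ) / 2 - 1))) * (C * ((w : ℝ) ^ (2 * c) * (1 / 2) ^ w)) := by
  have hc3 : (3 : ℝ) ≤ c := by exact_mod_cast hc
  have hΔ0 : (0 : ℝ) < Δ := by exact_mod_cast hΔ
  set h : ℝ := (c : ℝ) / 2 - 1 with hh
  have hpos : 0 < h := by rw [hh]; linarith
  set A : ℝ := 1 + (c : ℝ) / 2 * (1 + Real.log (Δ / 2)) with hA
  -- The product is at most `exp (w (A + h log (w/n)))`. For `w ≤ εn` this `ε` makes the bracket at
  -- most `-log 2`; the constant 8 is `2^3`.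
  refine ⟨Real.exp ((-Real.log 2 - A) / h), Real.exp (3 * A) * 8, Real.exp_pos _, by positivity, ?_⟩
  intro n w hn hw hwn
  have hn0 : (0 : ℝ) < n := by exact_mod_cast hn
  have hw0 : (0 : ℝ) < w := by exact_mod_cast (by omega : 0 < w)
  have hw3 : (3 : ℝ) ≤ w := by exact_mod_cast hw
  set L := Real.log ((w : ℝ) / n) with hL
  have hL1 : L ≤ (-Real.log 2 - A) / h := by
    rw [hL, Real.log_le_iff_le_exp (by positivity), div_le_iff₀ hn0]
    exact hwn
  have hL2 : A + h * L ≤ -Real.log 2 := by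
    have := mul_le_mul_of_nonneg_left hL1 hpos.le
    rw [mul_div_cancel₀ _ hpos.ne'] at this
    linarith
  have hlogmul : Real.log ((Δ : ℝ) / 2 * (w / n)) = Real.log (Δ / 2) + L := by
    rw [Real.log_mul (by positivity) (by positivity)]
  have e1 : (n.choose w : ℝ) * Real.exp (w * (c / 2) * (1 + Real.log (Δ / 2 * (w / n))))
      ≤ Real.exp (w * (A + h * L)) := by
    refine (mul_le_mul_of_nonneg_right (choose_le_exp (by omega) hn) (Real.exp_pos _).le).trans ?_
    rw [← Real.exp_add, hlogmul]
    apply Real.exp_le_exp.2 (le_of_eq _)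
    rw [hA, hh]
    ring
  refine e1.trans ?_
  -- Three of the `w` factors are kept to produce `n^(-3h)`; each of the others is at most `1/2`,
  -- which makes the sum over `w` converge.
  have e2 : Real.exp (w * (A + h * L)) ≤ Real.exp (3 * (A + h * L))
      * Real.exp ((w - 3) * (-Real.log 2)) := by
    rw [← Real.exp_add]
    apply Real.exp_le_exp.2
    have := mul_le_mul_of_nonneg_left hL2 (sub_nonneg.2 hw3)
    linarith
  refine e2.trans ?_
  have e3 : Real.exp (3 * (A + h * L))
      = Real.exp (3 * A) * ((w : ℝ) ^ (3 * h) * (n : ℝ) ^ (-(3 * h))) := by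
    rw [Real.rpow_def_of_pos hw0, Real.rpow_def_of_pos hn0, ← Real.exp_add, ← Real.exp_add, hL,
      Real.log_div hw0.ne' hn0.ne']
    ring_nf
  have e4 : Real.exp (((w : ℝ) - 3) * (-Real.log 2)) = 8 * (1 / 2) ^ w := by
    have : Real.exp ((w : ℝ) * (-Real.log 2)) = (1 / 2) ^ w := by
      rw [Real.exp_nat_mul, ← Real.log_inv, Real.exp_log (by norm_num)]
      norm_num
    have h8 : Real.exp (3 * Real.log 2) = 8 := by
      rw [show (3 : ℝ) = ((3 : ℕ) : ℝ) by norm_num, ← Real.log_pow, Real.exp_log (by norm_num)]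
      norm_num
    rw [← this, ← h8, ← Real.exp_add]
    ring_nf
  have e5 : (w : ℝ) ^ (3 * h) ≤ (w : ℝ) ^ (2 * c) := by
    rw [← Real.rpow_natCast]
    refine Real.rpow_le_rpow_of_exponent_le (by linarith) ?_
    rw [hh]; push_cast; linarith
  rw [e3, e4]
  calc Real.exp (3 * A) * ((w : ℝ) ^ (3 * h) * (n : ℝ) ^ (-(3 * h))) * (8 * (1 / 2) ^ w)
      ≤ Real.exp (3 * A) * ((w : ℝ) ^ (2 * c) * (n : ℝ) ^ (-(3 * h))) * (8 * (1 / 2) ^ w) := by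
        gcongr
    _ = _ := by ring

end SmallWeights

/-! ### The threshold in natural logarithms -/

section EvenProb

variable {Δ : ℕ}

lemma evenProb_pos (hΔ : Δ ≠ 0) {y : ℝ} (h0 : 0 < y) (h1 : y < 1) : 0 < evenProb Δ y := by
  have h : |1 - 2 * y| < 1 := abs_lt.2 ⟨by linarith, by linarith⟩
  have h2 : |(1 - 2 * y) ^ Δ| < 1 := by
    rw [abs_pow]; exact pow_lt_one₀ (abs_nonneg _) h hΔ
  have := (abs_lt.1 h2).1
  rw [evenProb]; linarith

lemma evenProb_lt_one (hΔ : Δ ≠ 0) {y : ℝ} (h0 : 0 < y) (h1 : y < 1) : evenProb Δ y < 1 := by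
  have h : |1 - 2 * y| < 1 := abs_lt.2 ⟨by linarith, by linarith⟩
  have h2 : |(1 - 2 * y) ^ Δ| < 1 := by
    rw [abs_pow]; exact pow_lt_one₀ (abs_nonneg _) h hΔ
  have := (abs_lt.1 h2).2
  rw [evenProb]; linarith

lemma continuous_evenProb (Δ : ℕ) : Continuous (evenProb Δ) := by
  unfold evenProb
  fun_prop

/-- The entropy bound for the number of typical shifts, in nats. -/
noncomputable def shiftEntropy (p x : ℝ) : ℝ :=
  p * Real.binEntropy (x / (2 * p)) + (1 - p) * Real.binEntropy (x / (2 * (1 - p)))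

lemma entropy2_eq (x : ℝ) : entropy2 x = Real.binEntropy x / Real.log 2 := by
  rw [entropy2, Real.binEntropy, Real.log_inv, Real.log_inv, Real.logb, Real.logb]
  ring

lemma ratio_eq {p x : ℝ} (hΔ : Δ ≠ 0) (h0 : 0 < x) (h1 : x < 1) :
    ratio Δ p x = shiftEntropy p x / (-Real.log (evenProb Δ x)) := by
  have hl2 : Real.log 2 ≠ 0 := (Real.log_pos one_lt_two).ne'
  have h2 : (1 + (1 - 2 * x) ^ Δ) = 2 * evenProb Δ x := by rw [evenProb]; ring
  have h3 : 1 - Real.logb 2 (1 + (1 - 2 * x) ^ Δ) = -Real.log (evenProb Δ x) / Real.log 2 := by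
    rw [h2, Real.logb, Real.log_mul two_ne_zero (evenProb_pos hΔ h0 h1).ne']
    field_simp
    ring
  have h4 : p * entropy2 (x / (2 * p)) + (1 - p) * entropy2 (x / (2 * (1 - p)))
      = shiftEntropy p x / Real.log 2 := by
    rw [entropy2_eq, entropy2_eq, shiftEntropy]; ring
  rw [ratio, h3, h4, div_div_div_cancel_right₀ hl2]

lemma continuous_shiftEntropy (p : ℝ) : Continuous (shiftEntropy p) := by
  unfold shiftEntropy
  fun_prop

lemma beta_pos (c Δ : ℕ) (hΔ : 0 < Δ) {p : ℝ} (hp₀ : 0 < p) (hp₁ : p < 1) : 0 < beta c Δ p := by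
  have hΔ0 : (0 : ℝ) < Δ := by exact_mod_cast hΔ
  have : 0 < 1 - p := by linarith
  unfold beta
  positivity

lemma ratio_le_threshold (c : ℕ) (hΔ : 0 < Δ) {p x : ℝ} (hp₀ : 0 < p) (hp : p < 1 / 2)
    (hx : x ∈ Set.Icc (beta c Δ p) (2 * p)) : ratio Δ p x ≤ threshold c Δ p := by
  have hβ := beta_pos c Δ hΔ hp₀ (by linarith)
  have hmem : ∀ y ∈ Set.Icc (beta c Δ p) (2 * p), 0 < y ∧ y < 1 := fun y hy =>
    ⟨hβ.trans_le hy.1, by linarith [hy.2]⟩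
  refine le_csSup (IsCompact.bddAbove (isCompact_Icc.image_of_continuousOn ?_))
    (Set.mem_image_of_mem _ hx)
  have h : ContinuousOn (fun y => shiftEntropy p y / (-Real.log (evenProb Δ y)))
      (Set.Icc (beta c Δ p) (2 * p)) := by
    refine (continuous_shiftEntropy p).continuousOn.div ?_ ?_
    · exact ((continuous_evenProb Δ).continuousOn.log
        fun y hy => (evenProb_pos hΔ.ne' (hmem y hy).1 (hmem y hy).2).ne').neg
    · intro y hy
      have := Real.log_neg (evenProb_pos hΔ.ne' (hmem y hy).1 (hmem y hy).2)
        (evenProb_lt_one hΔ.ne' (hmem y hy).1 (hmem y hy).2)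
      linarith
  exact h.congr fun y hy => ratio_eq hΔ.ne' (hmem y hy).1 (hmem y hy).2

/-- Since `m/n = c/Δ`, the left side is the exponential rate of (number of shifts) times
(probability that all queries are even). -/
lemma shiftEntropy_add_neg (c : ℕ) (hΔ : 0 < Δ) {p x : ℝ} (hp₀ : 0 < p) (hp : p < 1 / 2)
    (hx : x ∈ Set.Icc (beta c Δ p) (2 * p)) (hthr : threshold c Δ p < (c : ℝ) / Δ) :
    shiftEntropy p x + c / Δ * Real.log (evenProb Δ x) < 0 := by
  have hβ := beta_pos c Δ hΔ hp₀ (by linarith)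
  have h0 : 0 < x := hβ.trans_le hx.1
  have h1 : x < 1 := by linarith [hx.2]
  have h2 := (ratio_le_threshold c hΔ hp₀ hp hx).trans_lt hthr
  have h3 : 0 < -Real.log (evenProb Δ x) := by
    have := Real.log_neg (evenProb_pos hΔ.ne' h0 h1) (evenProb_lt_one hΔ.ne' h0 h1)
    linarith
  rw [ratio_eq hΔ.ne' h0 h1, div_lt_iff₀ h3] at h2
  linarith

end EvenProb

end XorQuery

namespace XorQuery
open Finset Filter Topology

/-! ### Exponential rates -/

section Rates

variable {p : ℝ}

/-- Exponential rate of the bound `card_typical_shift_le` with parameters `s`, `t`. -/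
noncomputable def shiftRate (p s t y : ℝ) : ℝ :=
  p * Real.log (1 + s) + (1 - p) * Real.log (1 + t) - y / 2 * (Real.log s + Real.log t)

lemma continuous_shiftRate (p s t : ℝ) : Continuous (shiftRate p s t) := by
  unfold shiftRate
  fun_prop

lemma log_odds_eq_binEntropy {u : ℝ} (h0 : 0 < u) (h1 : u < 1) :
    Real.log (1 + u / (1 - u)) - u * Real.log (u / (1 - u)) = Real.binEntropy u := by
  have h2 : 0 < 1 - u := by linarith
  have h3 : 1 + u / (1 - u) = (1 - u)⁻¹ := by field_simp; ring
  rw [h3, Real.log_div h0.ne' h2.ne', Real.binEntropy, Real.log_inv, Real.log_inv]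
  ring

/-- The optimal parameters are the odds of the fractions of ones and zeros that are flipped, and
they give the entropies exactly. The slack `η` is needed at `x = 2p`, where all ones are flipped and
the optimal `s` is infinite. -/
lemma exists_shiftRate_le (hp₀ : 0 < p) (hp : p < 1 / 2) {x η : ℝ} (hx0 : 0 < x)
    (hx : x ≤ 2 * p) (hη : 0 < η) :
    ∃ s t : ℝ, 0 < s ∧ 0 < t ∧ shiftRate p s t x ≤ shiftEntropy p x + η := by
  have hq : 0 < 1 - p := by linarith
  have hv0 : 0 < x / (2 * (1 - p)) := by positivity
  have hv1 : x / (2 * (1 - p)) < 1 := by rw [div_lt_one (by positivity)]; linarith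
  have hu0 : 0 < x / (2 * p) := by positivity
  have hu1 : x / (2 * p) ≤ 1 := by rw [div_le_one (by positivity)]; linarith
  have key : ∃ s : ℝ, 0 < s ∧
      Real.log (1 + s) - x / (2 * p) * Real.log s ≤ Real.binEntropy (x / (2 * p)) + η / p := by
    rcases hu1.lt_or_eq with h | h
    · refine ⟨x / (2 * p) / (1 - x / (2 * p)), div_pos hu0 (by linarith), ?_⟩
      rw [log_odds_eq_binEntropy hu0 h]
      linarith [div_pos hη hp₀]
    -- A large finite `s` suffices: `log (1 + s) - log s = log (1 + 1/s) ≤ 1/s = η/p`.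
    · refine ⟨p / η, by positivity, ?_⟩
      have h1 : 1 + p / η = p / η * (1 + η / p) := by field_simp; ring
      rw [h, h1, Real.log_mul (by positivity) (by positivity), Real.binEntropy_one]
      have := Real.log_le_sub_one_of_pos (show 0 < 1 + η / p by positivity)
      linarith
  obtain ⟨s, hs0, hs⟩ := key
  have h1v : 0 < 1 - x / (2 * (1 - p)) := by linarith
  refine ⟨s, x / (2 * (1 - p)) / (1 - x / (2 * (1 - p))), hs0, by positivity, ?_⟩
  have ht := log_odds_eq_binEntropy hv0 hv1
  set v := x / (2 * (1 - p)) with hv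
  set u := x / (2 * p) with hu
  have e1 : x / 2 = p * u := by rw [hu]; field_simp
  have e2 : x / 2 = (1 - p) * v := by rw [hv]; field_simp
  have e3 : shiftRate p s (v / (1 - v)) x = p * (Real.log (1 + s) - u * Real.log s)
      + (1 - p) * (Real.log (1 + v / (1 - v)) - v * Real.log (v / (1 - v))) := by
    have : x / 2 * (Real.log s + Real.log (v / (1 - v)))
        = p * u * Real.log s + (1 - p) * v * Real.log (v / (1 - v)) := by
      rw [← e1, ← e2]; ring
    rw [shiftRate, this]; ring
  rw [e3, ht, shiftEntropy, ← hu, ← hv]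
  have := mul_le_mul_of_nonneg_left hs hp₀.le
  have e4 : p * (Real.binEntropy u + η / p) = p * Real.binEntropy u + η := by
    field_simp
  linarith

/-- This is where the formula for `β` is used. The parameters are those that are optimal for small
`x`; with `log (1 + s) ≤ s` the left side is at most `x/2` times an affine function of `log (Δx/2)`
with slope `c - 2`. -/
lemma shiftRate_add_neg_of_le_beta {c Δ : ℕ} (hc : 3 ≤ c) (hΔ : 0 < Δ) (hp₀ : 0 < p)
    (hp : p < 1 / 2) {x : ℝ} (hx0 : 0 < x) (hx : x ≤ beta c Δ p) :
    shiftRate p (x / (2 * p)) (x / (2 * (1 - p))) x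
      + x * (c / 2) * (1 + Real.log (Δ / 2 * x)) < 0 := by
  have hq : 0 < 1 - p := by linarith
  have hc3 : (3 : ℝ) ≤ c := by exact_mod_cast hc
  have hΔ0 : (0 : ℝ) < Δ := by exact_mod_cast hΔ
  have hs := Real.log_le_sub_one_of_pos (show 0 < 1 + x / (2 * p) by positivity)
  have ht := Real.log_le_sub_one_of_pos (show 0 < 1 + x / (2 * (1 - p)) by positivity)
  have hs' := mul_le_mul_of_nonneg_left hs hp₀.le
  have ht' := mul_le_mul_of_nonneg_left ht hq.le
  have e1 : p * (1 + x / (2 * p) - 1) = x / 2 := by field_simp; ring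
  have e2 : (1 - p) * (1 + x / (2 * (1 - p)) - 1) = x / 2 := by field_simp; ring
  have hz0 : 0 < (Δ : ℝ) / 2 * x := by positivity
  set lz := Real.log ((Δ : ℝ) / 2 * x) with hlz
  have l1 : Real.log (x / (2 * p)) = lz - Real.log Δ - Real.log p := by
    rw [hlz, ← Real.log_div hz0.ne' hΔ0.ne', ← Real.log_div (by positivity) hp₀.ne']
    congr 1; field_simp
  have l2 : Real.log (x / (2 * (1 - p))) = lz - Real.log Δ - Real.log (1 - p) := by
    rw [hlz, ← Real.log_div hz0.ne' hΔ0.ne', ← Real.log_div (by positivity) hq.ne']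
    congr 1; field_simp
  have hβ : ((c : ℝ) - 2) * lz ≤
      -(Real.log 2 + 2 * Real.log Δ + Real.log p + Real.log (1 - p) + 3 * c / 2) := by
    have h1 : (Δ : ℝ) / 2 * x
        ≤ (1 / (2 * (Δ : ℝ) ^ 2 * p * (1 - p) * Real.exp (3 * c / 2))) ^ (1 / ((c : ℝ) - 2)) := by
      rw [beta] at hx
      calc (Δ : ℝ) / 2 * x ≤ Δ / 2 * (2 / Δ * _) := mul_le_mul_of_nonneg_left hx (by positivity)
        _ = _ := by field_simp
    have hlog : Real.log (1 / (2 * (Δ : ℝ) ^ 2 * p * (1 - p) * Real.exp (3 * c / 2)))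
        = -(Real.log 2 + 2 * Real.log Δ + Real.log p + Real.log (1 - p) + 3 * c / 2) := by
      rw [one_div, Real.log_inv,
        Real.log_mul (by positivity) (by positivity), Real.log_mul (by positivity) (by positivity),
        Real.log_mul (by positivity) (by positivity), Real.log_mul (by positivity) (by positivity),
        Real.log_exp, Real.log_pow]
      push_cast
      ring
    have h2 := Real.log_le_log hz0 h1
    rw [Real.log_rpow (by positivity), hlog] at h2
    have h3 := mul_le_mul_of_nonneg_left h2 (show (0 : ℝ) ≤ c - 2 by linarith)
    have hc2 : (c : ℝ) - 2 ≠ 0 := by linarith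
    rwa [← mul_assoc, mul_one_div_cancel hc2, one_mul] at h3
  -- By the bound on `lz` the left side is at most `2 - c/2 - log 2`, which is negative because `c ≥
  -- 3` and `log 2 > 1/2`.
  have hmain : 2 + c + c * lz - (lz - Real.log Δ - Real.log p)
      - (lz - Real.log Δ - Real.log (1 - p)) < 0 := by
    have := Real.log_two_gt_d9
    linarith
  rw [shiftRate, l1, l2]
  nlinarith [mul_neg_of_pos_of_neg hx0 hmain]

end Rates

/-! ### Asymptotic estimates for the dense bound -/

section Estimates

lemma eventually_sublinear (M b : ℝ) (hb : 0 < b) {γ : ℝ} (hγ : 0 < γ) :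
    ∀ᶠ n : ℕ in atTop, M * (n : ℝ) ^ (2 / 3 : ℝ) + Real.log (n * b + 1) + Real.log 2 ≤ γ * n := by
  have hnat : Tendsto (fun n : ℕ => (n : ℝ)) atTop atTop := tendsto_natCast_atTop_atTop
  have h1 : ∀ᶠ n : ℕ in atTop, M * (n : ℝ) ^ (2 / 3 : ℝ) ≤ γ / 4 * n := by
    have h : Tendsto (fun n : ℕ => (n : ℝ) ^ (1 / 3 : ℝ)) atTop atTop :=
      (tendsto_rpow_atTop (by norm_num)).comp hnat
    filter_upwards [h.eventually_ge_atTop (4 * M / γ), eventually_gt_atTop 0] with n hn hn0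
    have hn0 : (0 : ℝ) < n := by exact_mod_cast hn0
    have h2 : (n : ℝ) = (n : ℝ) ^ (2 / 3 : ℝ) * (n : ℝ) ^ (1 / 3 : ℝ) := by
      rw [← Real.rpow_add hn0]; norm_num
    rw [div_le_iff₀ hγ] at hn
    have h3 : 0 ≤ (n : ℝ) ^ (2 / 3 : ℝ) := by positivity
    calc M * (n : ℝ) ^ (2 / 3 : ℝ)
        ≤ ((n : ℝ) ^ (1 / 3 : ℝ) * γ / 4) * (n : ℝ) ^ (2 / 3 : ℝ) := by gcongr; linarith
      _ = γ / 4 * ((n : ℝ) ^ (2 / 3 : ℝ) * (n : ℝ) ^ (1 / 3 : ℝ)) := by ring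
      _ = γ / 4 * n := by rw [← h2]
  have h2 : ∀ᶠ n : ℕ in atTop, Real.log (n * b + 1) ≤ γ / (4 * b) * (n * b + 1) := by
    have ht : Tendsto (fun n : ℕ => (n : ℝ) * b + 1) atTop atTop :=
      tendsto_atTop_add_const_right _ _ (hnat.atTop_mul_const hb)
    have := (Real.isLittleO_log_id_atTop.comp_tendsto ht).bound (show 0 < γ / (4 * b) by positivity)
    filter_upwards [this] with n hn
    simp only [Function.comp_apply, id, Real.norm_eq_abs] at hn
    have h3 : (0 : ℝ) ≤ n * b + 1 := by positivity
    rw [abs_of_nonneg h3] at hn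
    exact (le_abs_self _).trans hn
  have h3 : ∀ᶠ n : ℕ in atTop, γ / (4 * b) + Real.log 2 ≤ γ / 4 * n :=
    (hnat.const_mul_atTop (by positivity)).eventually_ge_atTop _
  filter_upwards [h1, h2, h3] with n h1 h2 h3
  have e : γ / (4 * b) * (n * b + 1) = γ / 4 * n + γ / (4 * b) := by field_simp
  have hn : 0 ≤ γ / 4 * n := by positivity
  rw [e] at h2
  linarith

/-- Bounds the number of choices of the exceptional queries. The rate `δ - δ log δ` tends to zero
with `δ`. -/
lemma choose_floor_le_exp {δ : ℝ} (hδ : 0 < δ) (hδ1 : δ < 1) (m : ℕ) :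
    (m.choose ⌊δ * m⌋₊ : ℝ) ≤ Real.exp (m * (δ - δ * Real.log δ)) := by
  set K := ⌊δ * m⌋₊ with hK
  have h1 := choose_mul_pow_le_pow hδ.le m K
  have hKle : (K : ℝ) ≤ δ * m := Nat.floor_le (by positivity)
  have h2 : (1 + δ) ^ m ≤ Real.exp (m * δ) := by
    rw [Real.exp_nat_mul]
    gcongr
    rw [add_comm]
    exact Real.add_one_le_exp δ
  have h3 : δ ^ K = Real.exp (K * Real.log δ) := by
    rw [Real.exp_nat_mul, Real.exp_log hδ]
  have h4 : (m.choose K : ℝ) ≤ Real.exp (m * δ) / Real.exp (K * Real.log δ) := by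
    rw [le_div_iff₀ (Real.exp_pos _), ← h3]
    exact h1.trans h2
  rw [← Real.exp_sub] at h4
  refine h4.trans (Real.exp_le_exp.2 ?_)
  have := mul_le_mul_of_nonpos_right hKle (Real.log_neg hδ hδ1).le
  linarith

lemma pow_sub_floor_le_exp {δ e : ℝ} (hδ : 0 < δ) (hδ1 : δ < 1) (he : 0 < e) (he1 : e ≤ 1)
    (m : ℕ) : e ^ (m - ⌊δ * m⌋₊) ≤ Real.exp (m * ((1 - δ) * Real.log e)) := by
  set K := ⌊δ * m⌋₊ with hK
  have hKle : (K : ℝ) ≤ δ * m := Nat.floor_le (by positivity)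
  have hKm : K ≤ m := by
    have : (K : ℝ) ≤ m := hKle.trans (by nlinarith [Nat.cast_nonneg (α := ℝ) m])
    exact_mod_cast this
  have h3 : e ^ (m - K) = Real.exp ((m - K : ℕ) * Real.log e) := by
    rw [Real.exp_nat_mul, Real.exp_log he]
  rw [h3]
  apply Real.exp_le_exp.2
  rw [Nat.cast_sub hKm]
  have := mul_le_mul_of_nonpos_right hKle (Real.log_nonpos he.le he1)
  linarith

/-- A power of `O(1/n)` with linearly growing exponent decays superexponentially. -/
lemma eventually_div_pow_floor_le {C κ δ A : ℝ} (hC : 0 < C) (hκ : 0 < κ) (hδ : 0 < δ) (hA : 0 ≤ A) :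
    ∀ᶠ n : ℕ in atTop, ∀ m : ℕ, (m : ℝ) = n * κ →
      (C / n) ^ ⌊δ * m⌋₊ ≤ Real.exp (-(A * n)) := by
  have hnat : Tendsto (fun n : ℕ => (n : ℝ)) atTop atTop := tendsto_natCast_atTop_atTop
  filter_upwards [hnat.eventually_ge_atTop (C * Real.exp (2 * A / (δ * κ))),
    hnat.eventually_ge_atTop (2 / (δ * κ)), eventually_gt_atTop 0] with n h1 h2 hn0 m hm
  have hn0 : (0 : ℝ) < n := by exact_mod_cast hn0
  have hδκ : 0 < δ * κ := by positivity
  -- The base `C/n` falls below `exp (-B)`, and the exponent `⌊δm⌋` is at least `δκn/2`, which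
  -- accounts for the factor 2.
  set B := 2 * A / (δ * κ) with hB
  have hB0 : 0 ≤ B := by positivity
  have h3 : C / n ≤ Real.exp (-B) := by
    rw [Real.exp_neg, div_le_iff₀ hn0, inv_mul_eq_div, le_div_iff₀ (Real.exp_pos _)]
    exact h1
  have h4 : δ * κ * n / 2 ≤ (⌊δ * m⌋₊ : ℝ) := by
    have := (Nat.lt_floor_add_one (δ * m)).le
    rw [hm] at this ⊢
    rw [div_le_iff₀ hδκ] at h2
    nlinarith
  calc (C / n) ^ ⌊δ * m⌋₊ ≤ Real.exp (-B) ^ ⌊δ * m⌋₊ := by gcongr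
    _ = Real.exp (⌊δ * m⌋₊ * -B) := by rw [Real.exp_nat_mul]
    _ ≤ Real.exp (-(A * n)) := by
        apply Real.exp_le_exp.2
        have h5 := mul_le_mul_of_nonneg_right h4 hB0
        have h6 : δ * κ * n / 2 * B = A * n := by rw [hB]; field_simp
        linarith

end Estimates

/-! ### Union bound for weights linear in `n` -/

section LargeWeights

variable {c Δ : ℕ} {p : ℝ}

open Classical in
/-- The union bound over vectors of weight `w` whose sum with `x` is typical. -/
noncomputable def shiftBound (c Δ m : ℕ) {n : ℕ} (p : ℝ) (x : Fin n → ZMod 2) (w : ℕ) : ℝ :=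
  ∑ d ∈ univ.filter (fun d : Fin n → ZMod 2 => hammingNorm d = w ∧ IsTypical p (x + d)),
    uprob fun π : Matching n m c Δ => EvenOrParallel π (supp d)

lemma shiftBound_le {m n : ℕ} {s t : ℝ} (hs : 0 < s) (ht : 0 < t) (x : Fin n → ZMod 2)
    (hx : IsTypical p x) (w : ℕ) (hn : 0 < n) {b : ℝ} (hb0 : 0 ≤ b)
    (hb : ∀ S : Finset (Fin n), S.card = w →
      uprob (fun π : Matching n m c Δ => EvenOrParallel π S) ≤ b) :
    shiftBound c Δ m p x w ≤ Real.exp (n * shiftRate p s t (w / n)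
      + (|Real.log s - Real.log t| + |Real.log (1 + s) - Real.log (1 + t)|)
            * (n : ℝ) ^ (2 / 3 : ℝ)) * b := by
  classical
  have hn0 : (0 : ℝ) < n := by exact_mod_cast hn
  rw [shiftBound]
  refine (sum_le_card_nsmul _ _ b fun d hd => ?_).trans ?_
  · refine hb _ ?_
    rw [card_supp]
    exact (mem_filter.1 hd).2.1
  · rw [nsmul_eq_mul]
    refine mul_le_mul_of_nonneg_right ((card_typical_shift_le hs ht x hx w).trans (le_of_eq ?_)) hb0
    congr 2
    rw [shiftRate]
    field_simp

/-- `shiftBound` is exponentially small, uniformly in the weights with `w / n` near `x₀`. -/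
def LocallySmall (c Δ : ℕ) (p x₀ : ℝ) : Prop :=
  ∃ δ γ : ℝ, 0 < δ ∧ 0 < γ ∧ ∀ᶠ n : ℕ in atTop, ∀ m : ℕ, m * Δ = n * c →
    ∀ x : Fin n → ZMod 2, IsTypical p x → ∀ w : ℕ, |(w : ℝ) / n - x₀| < δ →
      shiftBound c Δ m p x w ≤ Real.exp (-(γ * n))

lemma locallySmall_of_le_beta (hc : 3 ≤ c) (hΔ : 0 < Δ) (hp₀ : 0 < p)
    (hp : p < 1 / 2) {x₀ : ℝ} (hx0 : 0 < x₀) (hx : x₀ ≤ beta c Δ p) : LocallySmall c Δ p x₀ := by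
  have hq : 0 < 1 - p := by linarith
  set s := x₀ / (2 * p) with hs
  set t := x₀ / (2 * (1 - p)) with ht
  have hs0 : 0 < s := by positivity
  have ht0 : 0 < t := by positivity
  have hΔ0 : (0 : ℝ) < Δ := by exact_mod_cast hΔ
  set G : ℝ → ℝ := fun y => shiftRate p s t y + y * (c / 2) * (1 + Real.log (Δ / 2 * y)) with hG
  have hG0 : G x₀ < 0 := shiftRate_add_neg_of_le_beta hc hΔ hp₀ hp hx0 hx
  have hcont : ContinuousAt G x₀ := by
    refine (continuous_shiftRate p s t).continuousAt.add
      (ContinuousAt.mul (by fun_prop) (continuousAt_const.add (ContinuousAt.log (by fun_prop) ?_)))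
    positivity
  -- Near `x₀` the rate stays below `-2γ`; one `γ` absorbs the terms of order `n^(2/3)`, the other
  -- is the decay that is claimed.
  set γ := -G x₀ / 4 with hγ
  have hγ0 : 0 < γ := by rw [hγ]; linarith
  have hev : ∀ᶠ y in 𝓝 x₀, G y < -(2 * γ) ∧ 0 < y :=
    (hcont.eventually_lt_const (by rw [hγ]; linarith)).and (lt_mem_nhds hx0)
  obtain ⟨δ, hδ0, hδ⟩ := Metric.eventually_nhds_iff.1 hev
  refine ⟨δ, γ, hδ0, hγ0, ?_⟩
  set M := |Real.log s - Real.log t| + |Real.log (1 + s) - Real.log (1 + t)| with hM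
  filter_upwards [eventually_sublinear M 1 one_pos hγ0, eventually_gt_atTop 0]
    with n hn hn0 m hm x hxt w hw
  have hn0' : (0 : ℝ) < n := by exact_mod_cast hn0
  obtain ⟨hGy, hy0⟩ := hδ (show dist ((w : ℝ) / n) x₀ < δ by rwa [Real.dist_eq])
  have hw0 : 0 < w := by
    rcases Nat.eq_zero_or_pos w with h | h
    · rw [h] at hy0; simp at hy0
    · exact h
  have hm0 : 0 < m := by
    rcases Nat.eq_zero_or_pos m with h | h
    · rw [h, zero_mul] at hm
      have : 0 < n * c := by positivity
      omega
    · exact h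
  have hb : ∀ S : Finset (Fin n), S.card = w →
      uprob (fun π : Matching n m c Δ => EvenOrParallel π S)
        ≤ Real.exp (w * (c / 2) * (1 + Real.log (Δ / 2 * (w / n)))) := by
    intro S hS
    have := uprob_evenOrParallel_le_exp hm hm0 hn0 (by omega) S (by omega)
    rwa [hS] at this
  refine (shiftBound_le hs0 ht0 x hxt w hn0 (Real.exp_pos _).le hb).trans ?_
  rw [← Real.exp_add]
  apply Real.exp_le_exp.2
  have e : (w : ℝ) * (c / 2) * (1 + Real.log (Δ / 2 * (w / n)))
      = n * (w / n * (c / 2) * (1 + Real.log (Δ / 2 * (w / n)))) := by field_simp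
  rw [e]
  have h1 := mul_lt_mul_of_pos_left hGy hn0'
  simp only [hG] at h1
  have h2 : 0 ≤ Real.log ((n : ℝ) * 1 + 1) := Real.log_nonneg (by linarith)
  have h3 := Real.log_pos one_lt_two
  linarith

/-- Continuity at `δ = 0`, where `δ log δ` is zero: a small fraction of queries may be exempted from
being even without spoiling the negative rate. -/
lemma exists_exceptional_fraction {a κ l : ℝ} (h : a + κ * l < 0) :
    ∃ δ : ℝ, 0 < δ ∧ δ < 1 ∧ a + κ * (δ - δ * Real.log δ + (1 - δ) * l) < 0 := by
  have hcont : Continuous fun δ : ℝ => a + κ * (δ - δ * Real.log δ + (1 - δ) * l) := by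
    have := Real.continuous_mul_log
    fun_prop
  have h0 : (fun δ : ℝ => a + κ * (δ - δ * Real.log δ + (1 - δ) * l)) 0 < 0 := by simpa using h
  have hev := (hcont.continuousAt (x := 0)).eventually_lt_const h0
  obtain ⟨r, hr0, hr⟩ := Metric.eventually_nhds_iff.1 hev
  refine ⟨min (r / 2) (1 / 2), by positivity, by
    exact (min_le_right _ _).trans_lt (by norm_num), hr ?_⟩
  rw [Real.dist_eq, sub_zero, abs_of_pos (by positivity)]
  exact (min_le_left _ _).trans_lt (by linarith)

lemma locallySmall_of_beta_le (hc : 3 ≤ c) (hcΔ : c < Δ) (hp₀ : 0 < p)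
    (hp : p < 1 / 2) (hthr : threshold c Δ p < (c : ℝ) / Δ) {x₀ : ℝ}
    (hx : x₀ ∈ Set.Icc (beta c Δ p) (2 * p)) : LocallySmall c Δ p x₀ := by
  have hΔ : 0 < Δ := by omega
  have hΔ0 : (0 : ℝ) < Δ := by exact_mod_cast hΔ
  have hc0 : (0 : ℝ) < c := by exact_mod_cast (by omega : 0 < c)
  have hx0 : 0 < x₀ := (beta_pos c Δ hΔ hp₀ (by linarith)).trans_le hx.1
  have hx1 : x₀ < 1 := by linarith [hx.2]
  have hneg := shiftEntropy_add_neg c hΔ hp₀ hp hx hthr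
  set κ : ℝ := (c : ℝ) / Δ with hκ
  have hκ0 : 0 < κ := by positivity
  obtain ⟨s, t, hs0, ht0, hst⟩ := exists_shiftRate_le hp₀ hp hx0 hx.2
    (show 0 < -(shiftEntropy p x₀ + κ * Real.log (evenProb Δ x₀)) / 2 by linarith)
  obtain ⟨ν, hν0, hν1, hν⟩ := exists_exceptional_fraction (a := shiftRate p s t x₀) (κ := κ)
    (l := Real.log (evenProb Δ x₀)) (by linarith)
  set τ := ν - ν * Real.log ν with hτ
  set F : ℝ → ℝ := fun y => shiftRate p s t y + κ * (τ + (1 - ν) * Real.log (evenProb Δ y)) with hF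
  have hF0 : F x₀ < 0 := hν
  set γ := -F x₀ / 4 with hγ
  have hγ0 : 0 < γ := by rw [hγ]; linarith
  -- The decay demanded of the parallel-edge term: enough to outweigh both the count of shifts and
  -- the choice of the exceptional queries. Any constant is available since that term is
  -- superexponentially small.
  set A := |shiftRate p s t x₀ + κ * τ| + 3 * γ with hA
  have hA0 : 0 ≤ A := by positivity
  have hcont : ContinuousAt F x₀ := by
    refine (continuous_shiftRate p s t).continuousAt.add
      (continuousAt_const.mul (continuousAt_const.add (continuousAt_const.mul
        ((continuous_evenProb Δ).continuousAt.log (evenProb_pos hΔ.ne' hx0 hx1).ne'))))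
  have hcont2 : ContinuousAt (fun y => shiftRate p s t y + κ * τ - A) x₀ :=
    ((continuous_shiftRate p s t).continuousAt.add continuousAt_const).sub continuousAt_const
  have hev : ∀ᶠ y in 𝓝 x₀, (F y < -(2 * γ) ∧ shiftRate p s t y + κ * τ - A < -(2 * γ))
      ∧ 0 < y ∧ y < 1 := by
    refine ((hcont.eventually_lt_const (by rw [hγ]; linarith)).and
      (hcont2.eventually_lt_const ?_)).and ((lt_mem_nhds hx0).and (gt_mem_nhds hx1))
    have := le_abs_self (shiftRate p s t x₀ + κ * τ)
    rw [hA]; linarith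
  obtain ⟨δ, hδ0, hδ⟩ := Metric.eventually_nhds_iff.1 hev
  refine ⟨δ, γ, hδ0, hγ0, ?_⟩
  set M := |Real.log s - Real.log t| + |Real.log (1 + s) - Real.log (1 + t)| with hM
  filter_upwards [eventually_sublinear M c hc0 hγ0, eventually_gt_atTop 0,
    eventually_div_pow_floor_le (show 0 < 4 * (Δ : ℝ) ^ 2 by positivity) hκ0 hν0 hA0]
    with n hn hn0 hpow m hm x hxt w hw
  have hn0' : (0 : ℝ) < n := by exact_mod_cast hn0
  obtain ⟨⟨hFy, hAy⟩, hy0, hy1⟩ := hδ (show dist ((w : ℝ) / n) x₀ < δ by rwa [Real.dist_eq])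
  set y := (w : ℝ) / n with hy
  have hw0 : 0 < w := by
    rcases Nat.eq_zero_or_pos w with h | h
    · rw [hy, h] at hy0; simp at hy0
    · exact h
  have hwn : w < n := by
    rw [hy, div_lt_one hn0'] at hy1
    exact_mod_cast hy1
  have hmκ : (m : ℝ) = n * κ := by
    have : (m : ℝ) * Δ = n * c := by exact_mod_cast hm
    rw [hκ]; field_simp; linarith
  set K := ⌊ν * m⌋₊ with hK
  have hKm : K ≤ m := by
    have : (K : ℝ) ≤ m := (Nat.floor_le (by positivity)).trans
      (by nlinarith [Nat.cast_nonneg (α := ℝ) m])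
    exact_mod_cast this
  -- Here `K ≤ m`, `mΔ = nc` and `Δ ≥ 4`, the last because `Δ > c ≥ 3`.
  have hK4 : 4 * K ≤ n * c := by
    rw [← hm, mul_comm 4]
    exact Nat.mul_le_mul hKm (by omega)
  have he0 := evenProb_pos hΔ.ne' hy0 hy1
  have he1 := evenProb_lt_one hΔ.ne' hy0 hy1
  have hb : ∀ S : Finset (Fin n), S.card = w →
      uprob (fun π : Matching n m c Δ => EvenOrParallel π S)
        ≤ Real.exp (m * τ) * ((n * c + 1) * Real.exp (m * ((1 - ν) * Real.log (evenProb Δ y)))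
          + Real.exp (-(A * n))) := by
    intro S hS
    have h1 := uprob_evenOrParallel_le hm (by omega) S (by omega) (by omega) K hKm hK4
    have h2 : 4 * (Δ : ℝ) ^ 2 * c / (n * c) = 4 * (Δ : ℝ) ^ 2 / n := by field_simp
    rw [hS, ← hy, h2] at h1
    have h3 := hpow m hmκ
    have h4 := choose_floor_le_exp hν0 hν1 m
    have h5 := pow_sub_floor_le_exp hν0 hν1 he0 he1.le m
    refine h1.trans ?_
    gcongr
  refine (shiftBound_le hs0 ht0 x hxt w hn0 (by positivity) hb).trans ?_
  rw [← hM, ← hy]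
  set L := M * (n : ℝ) ^ (2 / 3 : ℝ) with hL
  have hnc : (0 : ℝ) < n * c + 1 := by positivity
  have hlog0 : 0 ≤ Real.log ((n : ℝ) * c + 1) := Real.log_nonneg (by
    have : (0 : ℝ) ≤ n * c := by positivity
    linarith)
  have hhalf : Real.exp (-(γ * n)) / 2 = Real.exp (-(γ * n) - Real.log 2) := by
    rw [Real.exp_sub, Real.exp_log two_pos]
  have b1 : Real.exp (n * shiftRate p s t y + L) * (Real.exp (m * τ) * ((n * c + 1)
      * Real.exp (m * ((1 - ν) * Real.log (evenProb Δ y))))) ≤ Real.exp (-(γ * n)) / 2 := by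
    have : (n : ℝ) * c + 1 = Real.exp (Real.log (n * c + 1)) := (Real.exp_log hnc).symm
    rw [hhalf, this, ← Real.exp_add, ← Real.exp_add, ← Real.exp_add]
    apply Real.exp_le_exp.2
    have h1 := mul_lt_mul_of_pos_left hFy hn0'
    simp only [hF] at h1
    rw [hmκ]
    linarith
  have b2 : Real.exp (n * shiftRate p s t y + L) * (Real.exp (m * τ) * Real.exp (-(A * n)))
      ≤ Real.exp (-(γ * n)) / 2 := by
    rw [hhalf, ← Real.exp_add, ← Real.exp_add]
    apply Real.exp_le_exp.2
    have h1 := mul_lt_mul_of_pos_left hAy hn0'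
    rw [hmκ]
    linarith
  calc _ = Real.exp (n * shiftRate p s t y + L) * (Real.exp (m * τ) * ((n * c + 1)
      * Real.exp (m * ((1 - ν) * Real.log (evenProb Δ y)))))
      + Real.exp (n * shiftRate p s t y + L) * (Real.exp (m * τ) * Real.exp (-(A * n))) := by ring
    _ ≤ _ := by linarith

/-- `shiftBound` is exponentially small, uniformly in the weights above a fixed fraction of `n`. -/
lemma exists_large_weight_bound (hc : 3 ≤ c) (hcΔ : c < Δ) (hp₀ : 0 < p)
    (hp : p < 1 / 2) (hthr : threshold c Δ p < (c : ℝ) / Δ) {ε : ℝ} (hε : 0 < ε) :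
    ∃ γ : ℝ, 0 < γ ∧ ∀ᶠ n : ℕ in atTop, ∀ m : ℕ, m * Δ = n * c →
      ∀ x : Fin n → ZMod 2, IsTypical p x → ∀ w : ℕ, ε * n ≤ w →
        shiftBound c Δ m p x w ≤ Real.exp (-(γ * n)) := by
  classical
  have hnat : Tendsto (fun n : ℕ => (n : ℝ)) atTop atTop := tendsto_natCast_atTop_atTop
  -- A property inherited by subsets and finite unions, for compactness induction. Shifts may have
  -- weight up to `2pn + 2n^(2/3)`, slightly beyond `2pn`, so the ratio is truncated at `2p`; the
  -- excess is eventually smaller than the local radius.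
  let P : Set ℝ → Prop := fun A => ∃ γ : ℝ, 0 < γ ∧ ∀ᶠ n : ℕ in atTop, ∀ m : ℕ, m * Δ = n * c →
      ∀ x : Fin n → ZMod 2, IsTypical p x → ∀ w : ℕ,
        (w : ℝ) / n ≤ 2 * p + 2 * (n : ℝ) ^ (-(1 / 3) : ℝ) → min ((w : ℝ) / n) (2 * p) ∈ A →
        shiftBound c Δ m p x w ≤ Real.exp (-(γ * n))
  have hP : P (Set.Icc (min ε (2 * p)) (2 * p)) := by
    refine IsCompact.induction_on isCompact_Icc ?_ ?_ ?_ ?_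
    · exact ⟨1, one_pos, Eventually.of_forall fun n m _ x _ w _ h => absurd h (Set.notMem_empty _)⟩
    · rintro A B hAB ⟨γ, hγ, h⟩
      refine ⟨γ, hγ, ?_⟩
      filter_upwards [h] with n h m hm x hx w hw hwA
      exact h m hm x hx w hw (hAB hwA)
    · rintro A B ⟨γ, hγ, h⟩ ⟨γ', hγ', h'⟩
      refine ⟨min γ γ', lt_min hγ hγ', ?_⟩
      filter_upwards [h, h'] with n h h' m hm x hx w hw hwA
      rcases hwA with hwA | hwA
      · refine (h m hm x hx w hw hwA).trans (Real.exp_le_exp.2 (neg_le_neg ?_))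
        gcongr
        exact min_le_left _ _
      · refine (h' m hm x hx w hw hwA).trans (Real.exp_le_exp.2 (neg_le_neg ?_))
        gcongr
        exact min_le_right _ _
    · intro x₀ hx₀
      have hx0 : 0 < x₀ := (lt_min hε (by linarith)).trans_le hx₀.1
      have hloc : LocallySmall c Δ p x₀ := by
        rcases le_total x₀ (beta c Δ p) with h | h
        · exact locallySmall_of_le_beta hc (by omega) hp₀ hp hx0 h
        · exact locallySmall_of_beta_le hc hcΔ hp₀ hp hthr ⟨h, hx₀.2⟩
      obtain ⟨δ, γ, hδ, hγ, h⟩ := hloc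
      refine ⟨Metric.ball x₀ (δ / 2), mem_nhdsWithin_of_mem_nhds
        (Metric.ball_mem_nhds _ (by linarith)), γ, hγ, ?_⟩
      have hsmall : ∀ᶠ n : ℕ in atTop, (n : ℝ) ^ (-(1 / 3) : ℝ) < δ / 4 :=
        ((tendsto_rpow_neg_atTop (by norm_num : (0 : ℝ) < 1 / 3)).comp hnat).eventually_lt_const
          (by linarith)
      filter_upwards [h, hsmall] with n h hs m hm x hx w hw hwA
      refine h m hm x hx w ?_
      rw [Metric.mem_ball, Real.dist_eq, abs_lt] at hwA
      rw [abs_lt]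
      have h1 := min_le_left ((w : ℝ) / n) (2 * p)
      constructor
      · linarith [hwA.1]
      · rcases min_choice ((w : ℝ) / n) (2 * p) with h2 | h2 <;> rw [h2] at hwA <;>
          linarith [hwA.2]
  obtain ⟨γ, hγ, h⟩ := hP
  refine ⟨γ, hγ, ?_⟩
  filter_upwards [h, eventually_gt_atTop 0] with n h hn m hm x hx w hw
  have hn0 : (0 : ℝ) < n := by exact_mod_cast hn
  by_cases hwn : (w : ℝ) ≤ 2 * (n * p + (n : ℝ) ^ (2 / 3 : ℝ))
  · refine h m hm x hx w ?_ ⟨?_, min_le_right _ _⟩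
    · rw [div_le_iff₀ hn0]
      have : (n : ℝ) ^ (-(1 / 3) : ℝ) * n = (n : ℝ) ^ (2 / 3 : ℝ) := by
        nth_rewrite 2 [← Real.rpow_one (n : ℝ)]
        rw [← Real.rpow_add hn0]; norm_num
      rw [add_mul, mul_assoc 2 ((n : ℝ) ^ (-(1 / 3) : ℝ)), this]
      linarith
    · refine min_le_min_right _ ?_
      rwa [le_div_iff₀ hn0]
  · have : shiftBound c Δ m p x w = 0 := by
      rw [shiftBound]
      refine sum_eq_zero fun d hd => absurd ?_ hwn
      obtain ⟨h1, h2⟩ := (mem_filter.1 hd).2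
      rw [← h1]
      exact hammingNorm_le_of_typical hx h2
    rw [this]
    exact (Real.exp_pos _).le

end LargeWeights

end XorQuery

namespace XorQuery
open Finset Filter Topology

/-! ### Combining all weights -/

section UnionBound

variable {c Δ : ℕ} {p : ℝ}

lemma sum_typicalShifts_le {m n : ℕ} {γ ε C : ℝ} (hc : 3 ≤ c) (hn : 0 < n) (hN : m * Δ = n * c)
    (hC : 0 ≤ C)
    (hsmall : ∀ w : ℕ, 3 ≤ w → (w : ℝ) ≤ ε * n →
      (n.choose w : ℝ) * Real.exp (w * (c / 2) * (1 + Real.log (Δ / 2 * (w / n))))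
        ≤ (n : ℝ) ^ (-(3 * ((c : ℝ) / 2 - 1))) * (C * ((w : ℝ) ^ (2 * c) * (1 / 2) ^ w)))
    (x : Fin n → ZMod 2)
    (hlarge : ∀ w : ℕ, ε * n ≤ w → shiftBound c Δ m p x w ≤ Real.exp (-(γ * n)))
    (Qmat : Matching n m c Δ → Matrix (Fin m) (Fin n) (ZMod 2))
    (hQ : ∀ π d, (Qmat π).mulVec d = 0 → EvenOrParallel π (supp d)) {W : ℝ} (hW0 : 0 ≤ W)
    (hW : ∀ d, hammingNorm d = 1 → uprob (fun π => (Qmat π).mulVec d = 0) ≤ W) :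
    ∑ d ∈ typicalShifts p x, uprob (fun π => (Qmat π).mulVec d = 0)
      ≤ n * W + (n : ℝ) ^ 2 / 2 * ((Δ : ℝ) * c / n) ^ c
        + (n : ℝ) ^ (-(3 * ((c : ℝ) / 2 - 1))) * (C * ∑' w : ℕ, (w : ℝ) ^ (2 * c) * (1 / 2) ^ w)
        + (n + 1) * Real.exp (-(γ * n)) := by
  classical
  have hn0 : (0 : ℝ) < n := by exact_mod_cast hn
  have hm : 0 < m := by
    rcases Nat.eq_zero_or_pos m with h | h
    · rw [h, zero_mul] at hN
      have : 0 < n * c := by positivity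
      omega
    · exact h
  have hcard : ∀ w, (((typicalShifts p x).filter fun d => hammingNorm d = w).card : ℝ)
      ≤ n.choose w := by
    intro w
    rw [← card_hammingNorm_eq]
    exact_mod_cast card_le_card (filter_subset_filter _ (filter_subset _ _)
      |>.trans (filter_subset_filter _ (subset_univ _)))
  have hcount : ∀ w (b : ℝ), 0 ≤ b →
      (∀ d : Fin n → ZMod 2, hammingNorm d = w → uprob (fun π => (Qmat π).mulVec d = 0) ≤ b) →
      ∑ d ∈ (typicalShifts p x).filter (fun d => hammingNorm d = w),
        uprob (fun π => (Qmat π).mulVec d = 0) ≤ n.choose w * b := by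
    intro w b hb0 hb
    refine (sum_le_card_nsmul _ _ b fun d hd => hb d (mem_filter.1 hd).2).trans ?_
    rw [nsmul_eq_mul]
    exact mul_le_mul_of_nonneg_right (hcard w) hb0
  set g : ℕ → ℝ := fun w => (w : ℝ) ^ (2 * c) * (1 / 2) ^ w with hg
  have hg0 : ∀ w, 0 ≤ g w := fun w => by positivity
  set a := (n : ℝ) ^ (-(3 * ((c : ℝ) / 2 - 1))) with ha
  have ha0 : 0 ≤ a := by positivity
  set B := (n : ℝ) ^ 2 / 2 * ((Δ : ℝ) * c / n) ^ c with hB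
  have hB0 : 0 ≤ B := by positivity
  -- Each weight falls under one of the four estimates; bounding it by their sum lets the summation
  -- over `w` proceed without cases.
  have hterm : ∀ w ∈ range (n + 1),
      ∑ d ∈ (typicalShifts p x).filter (fun d => hammingNorm d = w),
        uprob (fun π => (Qmat π).mulVec d = 0)
      ≤ (if w = 1 then n * W else 0) + (if w = 2 then B else 0) + a * (C * g w)
        + Real.exp (-(γ * n)) := by
    intro w _
    have hgw : 0 ≤ a * (C * g w) := mul_nonneg ha0 (mul_nonneg hC (hg0 w))
    have hexp := (Real.exp_pos (-(γ * n))).le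
    rcases lt_or_ge w 3 with hw | hw
    · interval_cases w
      · rw [sum_eq_zero]
        · simp; linarith
        · intro d hd
          have h1 := hammingNorm_eq_zero.1 (mem_filter.1 hd).2
          have h2 := (mem_filter.1 (mem_filter.1 hd).1).2.1
          exact absurd h1 h2
      · have := hcount 1 W hW0 hW
        rw [Nat.choose_one_right] at this
        simp only [if_true, OfNat.one_ne_ofNat, if_false]
        linarith
      · have := hcount 2 (((Δ : ℝ) * c / n) ^ c) (by positivity) fun d hd =>
          (uprob_mono fun π => hQ π d).trans
            (uprob_evenOrParallel_pair_le hN hm hn (by omega) (supp d) (by rw [card_supp, hd]))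
        have h2 : (n.choose 2 : ℝ) * ((Δ : ℝ) * c / n) ^ c ≤ B := by
          rw [hB]
          gcongr
          have := Nat.choose_le_pow_div (α := ℝ) 2 n
          simpa using this
        simp only [OfNat.ofNat_ne_one, if_true, if_false]
        linarith
    · have h1 : w ≠ 1 := by omega
      have h2 : w ≠ 2 := by omega
      simp only [h1, h2, if_false]
      rcases le_total (w : ℝ) (ε * n) with hwn | hwn
      · have := hcount w (Real.exp (w * (c / 2) * (1 + Real.log (Δ / 2 * (w / n)))))
          (Real.exp_pos _).le fun d hd => (uprob_mono fun π => hQ π d).trans (by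
            have := uprob_evenOrParallel_le_exp hN hm hn (by omega) (supp d)
              (by rw [card_supp, hd]; omega)
            rwa [card_supp, hd] at this)
        have h3 := this.trans (hsmall w hw hwn)
        linarith
      · have h3 : ∑ d ∈ (typicalShifts p x).filter (fun d => hammingNorm d = w),
            uprob (fun π => (Qmat π).mulVec d = 0) ≤ shiftBound c Δ m p x w := by
          rw [shiftBound]
          refine (sum_le_sum fun d _ => uprob_mono fun π => hQ π d).trans
            (sum_le_sum_of_subset_of_nonneg (fun d hd => ?_) fun d _ _ => uprob_nonneg _)
          have h4 := mem_filter.1 hd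
          exact mem_filter.2 ⟨mem_univ _, h4.2, (mem_filter.1 h4.1).2.2⟩
        have := hlarge w hwn
        linarith
  rw [← sum_fiberwise_of_maps_to (t := range (n + 1)) (g := fun d => hammingNorm d)
    (fun d _ => mem_range.2 (Nat.lt_succ_of_le (hammingNorm_le d)))]
  refine (sum_le_sum hterm).trans ?_
  rw [sum_add_distrib, sum_add_distrib, sum_add_distrib, sum_ite_eq', sum_ite_eq', ← mul_sum,
    ← mul_sum, sum_const, card_range, nsmul_eq_mul]
  have hsum : Summable g := summable_pow_mul_geometric_of_norm_lt_one (2 * c)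
    (show ‖(1 / 2 : ℝ)‖ < 1 by norm_num)
  have h1 : ∑ w ∈ range (n + 1), g w ≤ ∑' w, g w := hsum.sum_le_tsum _ fun w _ => hg0 w
  have h2 : a * (C * ∑ w ∈ range (n + 1), g w) ≤ a * (C * ∑' w, g w) := by gcongr
  have hnW : 0 ≤ n * W := by positivity
  have h3 : (if 1 ∈ range (n + 1) then n * W else 0) ≤ n * W := by split_ifs <;> linarith
  have h4 : (if 2 ∈ range (n + 1) then B else 0) ≤ B := by split_ifs <;> linarith
  push_cast
  linarith

lemma errorProb_le_one {n m : ℕ} (hp₀ : 0 ≤ p) (hp₁ : p ≤ 1)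
    (Qmat : Matching n m c Δ → Matrix (Fin m) (Fin n) (ZMod 2)) (Ψ : Decoder n m) :
    errorProb p Qmat Ψ ≤ 1 := by
  classical
  rw [errorProb, ← sum_labelProb (n := n) p]
  refine sum_le_sum fun x _ => mul_le_of_le_one_right (labelProb_nonneg hp₀ hp₁ x) ?_
  apply div_le_one_of_le₀ _ (by positivity)
  exact_mod_cast card_le_univ _

end UnionBound

/-! ### Limits of the error terms -/

section Limits

lemma tendsto_exp_cbrt_mul_pow (k : ℕ) :
    Tendsto (fun n : ℕ => 2 * Real.exp (-(n : ℝ) ^ (1 / 3 : ℝ) / 4) * (n : ℝ) ^ k) atTop (𝓝 0) := by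
  have hcb : Tendsto (fun n : ℕ => (n : ℝ) ^ (1 / 3 : ℝ)) atTop atTop :=
    (tendsto_rpow_atTop (by norm_num)).comp tendsto_natCast_atTop_atTop
  have h := ((tendsto_rpow_mul_exp_neg_mul_atTop_nhds_zero (3 * k) (1 / 4)
    (by norm_num)).comp hcb).const_mul 2
  rw [mul_zero] at h
  refine h.congr fun n => ?_
  simp only [Function.comp_apply]
  have e : ((n : ℝ) ^ (1 / 3 : ℝ)) ^ (3 * k : ℝ) = (n : ℝ) ^ k := by
    rw [← Real.rpow_mul (Nat.cast_nonneg n), ← Real.rpow_natCast]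
    congr 1
    ring
  rw [e]
  ring_nf

lemma tendsto_succ_mul_exp_mul_pow {γ : ℝ} (hγ : 0 < γ) (k : ℕ) :
    Tendsto (fun n : ℕ => ((n : ℝ) + 1) * Real.exp (-(γ * n)) * (n : ℝ) ^ k) atTop (𝓝 0) := by
  have hnat : Tendsto (fun n : ℕ => (n : ℝ)) atTop atTop := tendsto_natCast_atTop_atTop
  have h1 := (tendsto_rpow_mul_exp_neg_mul_atTop_nhds_zero ((k + 1 : ℕ) : ℝ) γ hγ).comp hnat
  have h2 := (tendsto_rpow_mul_exp_neg_mul_atTop_nhds_zero (k : ℝ) γ hγ).comp hnat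
  have h := h1.add h2
  rw [add_zero] at h
  refine h.congr fun n => ?_
  simp only [Function.comp_apply, Real.rpow_natCast]
  ring_nf

/-- The exponents add up to `-(c/2 - 1) < 0`: weights from 3 on are of smaller order than the main
term `n^(2-c)`. -/
lemma tendsto_rpow_mul_pow {c : ℕ} (hc : 3 ≤ c) (C : ℝ) :
    Tendsto (fun n : ℕ => (n : ℝ) ^ (-(3 * ((c : ℝ) / 2 - 1))) * C * (n : ℝ) ^ (c - 2))
      atTop (𝓝 0) := by
  have hc3 : (3 : ℝ) ≤ c := by exact_mod_cast hc
  have h := ((tendsto_rpow_neg_atTop (show 0 < (c : ℝ) / 2 - 1 by linarith)).comp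
    tendsto_natCast_atTop_atTop).mul_const C
  rw [zero_mul] at h
  refine h.congr' ?_
  filter_upwards [eventually_gt_atTop 0] with n hn
  have hn0 : (0 : ℝ) < n := by exact_mod_cast hn
  simp only [Function.comp_apply]
  rw [mul_right_comm, ← Real.rpow_natCast, ← Real.rpow_add hn0, Nat.cast_sub (by omega)]
  congr 2
  push_cast
  ring

end Limits

/-! ### Error bound and main theorem -/

section Main

variable {c Δ : ℕ} {p : ℝ}

/-- Error bound for every query matrix whose kernel vectors see only queries that are even or have
parallel edges; `W` bounds the probability that a vector of weight one is in the kernel. -/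
lemma exists_errorProb_bound (hc : 3 ≤ c) (hcΔ : c < Δ) (hp₀ : 0 < p) (hp : p < 1 / 2)
    (hthr : threshold c Δ p < (c : ℝ) / Δ) :
    ∃ r : ℕ → ℝ, (∀ n, 0 ≤ r n) ∧ Tendsto (fun n => r n * (n : ℝ) ^ (c - 2)) atTop (𝓝 0) ∧
      ∀ n m : ℕ, 0 < n → m * Δ = n * c →
        ∀ Qmat : Matching n m c Δ → Matrix (Fin m) (Fin n) (ZMod 2),
        (∀ π d, (Qmat π).mulVec d = 0 → EvenOrParallel π (supp d)) →
        ∀ W : ℝ, 0 ≤ W →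
        (∀ d, hammingNorm d = 1 → uprob (fun π => (Qmat π).mulVec d = 0) ≤ W) →
        ∀ Ψ : Decoder n m, IsTypicalSetDecoder p Ψ →
          errorProb p Qmat Ψ ≤
            r n + (n : ℝ) ^ (2 - (c : ℤ)) * (1 - p + p ^ 2) * ((Δ : ℝ) * c) ^ c + n * W := by
  obtain ⟨ε, C, hε, hC, hsmall⟩ := exists_small_weight_bound c Δ hc (by omega)
  obtain ⟨γ, hγ, hlarge⟩ := exists_large_weight_bound hc hcΔ hp₀ hp hthr hε
  obtain ⟨n₀, hn₀⟩ := eventually_atTop.1 hlarge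
  set T := ∑' w : ℕ, (w : ℝ) ^ (2 * c) * (1 / 2 : ℝ) ^ w with hT
  have hT0 : 0 ≤ T := tsum_nonneg fun w => by positivity
  set r₀ : ℕ → ℝ := fun n => 2 * Real.exp (-(n : ℝ) ^ (1 / 3 : ℝ) / 4)
    + (n : ℝ) ^ (-(3 * ((c : ℝ) / 2 - 1))) * (C * T) + (n + 1) * Real.exp (-(γ * n)) with hr₀
  have hr₀0 : ∀ n, 0 ≤ r₀ n := fun n => by positivity
  -- For the finitely many `n` below `n₀` the trivial bound one on the error probability is used.
  refine ⟨fun n => if n₀ ≤ n then r₀ n else 1, ?_, ?_, ?_⟩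
  · intro n
    dsimp only
    split_ifs
    · exact hr₀0 n
    · exact zero_le_one
  · have h := ((tendsto_exp_cbrt_mul_pow (c - 2)).add (tendsto_rpow_mul_pow hc (C * T))).add
      (tendsto_succ_mul_exp_mul_pow hγ (c - 2))
    rw [add_zero, add_zero] at h
    refine h.congr' ?_
    filter_upwards [eventually_ge_atTop n₀] with n hn
    rw [if_pos hn, hr₀]
    ring
  · intro n m hn hN Qmat hQ W hW0 hW Ψ hΨ
    have hn0 : (0 : ℝ) < n := by exact_mod_cast hn
    -- The pairs contribute the coefficient `1/2` from `C(n,2) ≤ n²/2`, which the stated coefficient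
    -- dominates.
    have hq : 1 / 2 ≤ 1 - p + p ^ 2 := by nlinarith [sq_nonneg (p - 1 / 2)]
    have hz : (n : ℝ) ^ (2 - (c : ℤ)) = (n : ℝ) ^ 2 / (n : ℝ) ^ c := by
      rw [zpow_sub₀ hn0.ne']
      norm_cast
    have hz0 : 0 < (n : ℝ) ^ (2 - (c : ℤ)) := by positivity
    have hmain0 : 0 ≤ (n : ℝ) ^ (2 - (c : ℤ)) * (1 - p + p ^ 2) * ((Δ : ℝ) * c) ^ c := by positivity
    have hnW : 0 ≤ n * W := by positivity
    dsimp only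
    split_ifs with h
    · have h1 := errorProb_le hp₀.le (by linarith) Qmat Ψ hΨ
        (R := n * W + (n : ℝ) ^ 2 / 2 * ((Δ : ℝ) * c / n) ^ c
          + (n : ℝ) ^ (-(3 * ((c : ℝ) / 2 - 1))) * (C * T)
          + (n + 1) * Real.exp (-(γ * n))) (by positivity)
        fun x hx => sum_typicalShifts_le hc hn hN hC (fun w => hsmall n w hn) x
          (hn₀ n h m hN x hx) Qmat hQ hW0 hW
      have h2 := atypicalProb_le hp₀.le (by linarith : p ≤ 1) hn
      have h3 : (n : ℝ) ^ 2 / 2 * ((Δ : ℝ) * c / n) ^ c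
          ≤ (n : ℝ) ^ (2 - (c : ℤ)) * (1 - p + p ^ 2) * ((Δ : ℝ) * c) ^ c := by
        have e : (n : ℝ) ^ 2 / 2 * ((Δ : ℝ) * c / n) ^ c
            = (n : ℝ) ^ (2 - (c : ℤ)) * (1 / 2) * ((Δ : ℝ) * c) ^ c := by
          rw [hz, div_pow]; ring
        rw [e]
        gcongr
      simp only [hr₀]
      linarith
    · have := errorProb_le_one hp₀.le (by linarith) Qmat Ψ
      linarith

lemma tendsto_zpow_mul {c : ℕ} (hc : 3 ≤ c) (C : ℝ) :
    Tendsto (fun n : ℕ => (n : ℝ) ^ (2 - (c : ℤ)) * C) atTop (𝓝 0) := by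
  have h : Tendsto (fun n : ℕ => (n : ℝ) ^ (2 - (c : ℤ))) atTop (𝓝 0) :=
    (tendsto_zpow_atTop_zero (by omega)).comp tendsto_natCast_atTop_atTop
  simpa using h.mul_const C

/-- The expression is a constant times `n^(1 - c/2)`. It is needed for the parity matrix with even
`c`, where a single element may be joined to every query by an even number of edges. -/
lemma tendsto_weight_one_bound {c : ℕ} (hc : 3 ≤ c) {Δ : ℕ} (hΔ : 0 < Δ) :
    Tendsto (fun n : ℕ => n * Real.exp (c / 2 * (1 + Real.log (Δ / 2 * (1 / n))))) atTop (𝓝 0) := by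
  have hc3 : (3 : ℝ) ≤ c := by exact_mod_cast hc
  have hΔ0 : (0 : ℝ) < Δ := by exact_mod_cast hΔ
  have h := ((tendsto_rpow_neg_atTop (show 0 < (c : ℝ) / 2 - 1 by linarith)).comp
    tendsto_natCast_atTop_atTop).mul_const (Real.exp (c / 2 * (1 + Real.log (Δ / 2))))
  rw [zero_mul] at h
  refine h.congr' ?_
  filter_upwards [eventually_gt_atTop 0] with n hn
  have hn0 : (0 : ℝ) < n := by exact_mod_cast hn
  simp only [Function.comp_apply]
  rw [Real.log_mul (by positivity) (by positivity), one_div, Real.log_inv,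
    Real.rpow_def_of_pos hn0, ← Real.exp_add]
  nth_rewrite 2 [← Real.exp_log hn0]
  rw [← Real.exp_add]
  ring_nf

lemma tendsto_of_tendsto_mul_pow {r : ℕ → ℝ} (hr : ∀ n, 0 ≤ r n) {k : ℕ}
    (h : Tendsto (fun n => r n * (n : ℝ) ^ k) atTop (𝓝 0)) : Tendsto r atTop (𝓝 0) := by
  refine tendsto_of_tendsto_of_tendsto_of_le_of_le' tendsto_const_nhds h
    (Eventually.of_forall hr) ?_
  filter_upwards [eventually_gt_atTop 0] with n hn
  exact le_mul_of_one_le_right (hr n) (one_le_pow₀ (by exact_mod_cast hn))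

end Main

end XorQuery

theorem mainTheorem2 (c Δ : ℕ) (hc : 3 ≤ c) (hcΔ : c < Δ) (p : ℝ) (hp₀ : 0 < p) (hp : p < 1 / 2) :
    ∃ ε η : ℕ → ℝ,
      Filter.Tendsto ε Filter.atTop (nhds 0) ∧ Filter.Tendsto η Filter.atTop (nhds 0) ∧
      ∀ n m : ℕ, 0 < n → m * Δ = n * c → (n : ℝ) * XorQuery.threshold c Δ p < m →
        ∀ Ψ : XorQuery.Decoder n m, XorQuery.IsTypicalSetDecoder p Ψ →
          (XorQuery.errorProb p (XorQuery.incidenceMatrix (c := c) (Δ := Δ)) Ψ ≤ η n ∧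
            XorQuery.errorProb p (XorQuery.incidenceMatrix (c := c) (Δ := Δ)) Ψ ≤
              (n : ℝ) ^ (2 - (c : ℤ)) * (1 - p + p ^ 2) * ((Δ : ℝ) * c) ^ c * (1 + ε n)) ∧
          (XorQuery.errorProb p (XorQuery.parityMatrix (c := c) (Δ := Δ)) Ψ ≤ η n ∧
            (Odd c →
              XorQuery.errorProb p (XorQuery.parityMatrix (c := c) (Δ := Δ)) Ψ ≤
                (n : ℝ) ^ (2 - (c : ℤ)) * (1 - p + p ^ 2) * ((Δ : ℝ) * c) ^ c * (1 + ε n))) := by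
  have hΔ : 0 < Δ := by omega
  have hΔ0 : (0 : ℝ) < Δ := by exact_mod_cast hΔ
  have hc0 : (0 : ℝ) < c := by exact_mod_cast (by omega : 0 < c)
  by_cases hthr : XorQuery.threshold c Δ p < (c : ℝ) / Δ
  swap
  -- Since `m/n = c/Δ` is forced, the condition on `m` does not depend on `n`; in this case no pair
  -- `(n, m)` satisfies it.
  · refine ⟨fun _ => 0, fun _ => 0, tendsto_const_nhds, tendsto_const_nhds, ?_⟩
    intro n m hn hN hm
    exfalso
    apply hthr
    have hn0 : (0 : ℝ) < n := by exact_mod_cast hn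
    have hN' : (m : ℝ) * Δ = n * c := by exact_mod_cast hN
    rw [lt_div_iff₀ hΔ0]
    have := mul_lt_mul_of_pos_right hm hΔ0
    rw [hN', mul_assoc] at this
    exact lt_of_mul_lt_mul_left this hn0.le
  obtain ⟨r, hr0, hr, hbound⟩ := XorQuery.exists_errorProb_bound hc hcΔ hp₀ hp hthr
  set q : ℝ := (1 - p + p ^ 2) * ((Δ : ℝ) * c) ^ c with hq
  have hq0 : 0 < q := by
    have : 0 < 1 - p + p ^ 2 := by nlinarith [sq_nonneg (p - 1 / 2)]
    positivity
  set W : ℕ → ℝ := fun n => Real.exp (c / 2 * (1 + Real.log (Δ / 2 * (1 / n)))) with hW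
  have hW0 : ∀ n, 0 ≤ W n := fun n => (Real.exp_pos _).le
  -- The first witness is the remainder `r n` relative to the main term `n^(2-c) q`. The second also
  -- includes the weight-one contribution `n * W n`, which covers the parity matrix for every `c`.
  refine ⟨fun n => r n * (n : ℝ) ^ (c - 2) / q, fun n => r n + (n : ℝ) ^ (2 - (c : ℤ)) * q + n * W n,
    ?_, ?_, ?_⟩
  · simpa using hr.div_const q
  · have h := ((XorQuery.tendsto_of_tendsto_mul_pow hr0 hr).add
      (XorQuery.tendsto_zpow_mul hc q)).add (XorQuery.tendsto_weight_one_bound hc hΔ)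
    rwa [add_zero, add_zero] at h
  · intro n m hn hN _ Ψ hΨ
    have hn0 : (0 : ℝ) < n := by exact_mod_cast hn
    have hnW : 0 ≤ n * W n := mul_nonneg hn0.le (hW0 n)
    have hm : 0 < m := by
      rcases Nat.eq_zero_or_pos m with h | h
      · rw [h, zero_mul] at hN
        have : 0 < n * c := by positivity
        omega
      · exact h
    have hrel : (n : ℝ) ^ (2 - (c : ℤ)) * (1 - p + p ^ 2) * ((Δ : ℝ) * c) ^ c
        * (1 + r n * (n : ℝ) ^ (c - 2) / q) = r n + (n : ℝ) ^ (2 - (c : ℤ)) * q := by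
      have hinv : (n : ℝ) ^ (2 - (c : ℤ)) * (n : ℝ) ^ (c - 2) = 1 := by
        rw [← zpow_natCast, ← zpow_add₀ hn0.ne', Nat.cast_sub (by omega)]
        simp
      rw [mul_assoc ((n : ℝ) ^ (2 - (c : ℤ))), ← hq]
      calc (n : ℝ) ^ (2 - (c : ℤ)) * q * (1 + r n * (n : ℝ) ^ (c - 2) / q)
          = r n * ((n : ℝ) ^ (2 - (c : ℤ)) * (n : ℝ) ^ (c - 2)) + (n : ℝ) ^ (2 - (c : ℤ)) * q := by
            field_simp
            ring
        _ = _ := by rw [hinv, mul_one]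
    have hzero : ∀ Qmat : XorQuery.Matching n m c Δ → Matrix (Fin m) (Fin n) (ZMod 2),
        (∀ π d, (Qmat π).mulVec d = 0 → XorQuery.EvenOrParallel π (XorQuery.supp d)) →
        (∀ π d, hammingNorm d = 1 → (Qmat π).mulVec d ≠ 0) →
        XorQuery.errorProb p Qmat Ψ ≤ r n + (n : ℝ) ^ (2 - (c : ℤ)) * q := by
      intro Qmat hQ h1
      have := hbound n m hn hN Qmat hQ 0 le_rfl
        (fun d hd => (XorQuery.uprob_eq_zero fun π => h1 π d hd).le) Ψ hΨ
      rw [hq]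
      linarith
    rw [hrel]
    have hinc := hzero (XorQuery.incidenceMatrix (c := c) (Δ := Δ))
      XorQuery.evenOrParallel_of_incidenceMatrix_mulVec_eq_zero
      (fun π d => XorQuery.incidenceMatrix_mulVec_ne_zero (by omega) π d)
    refine ⟨⟨by linarith, hinc⟩, ?_, fun hodd => ?_⟩
    · have := hbound n m hn hN (XorQuery.parityMatrix (c := c) (Δ := Δ))
        XorQuery.evenOrParallel_of_parityMatrix_mulVec_eq_zero (W n) (hW0 n)
        (fun d hd => (XorQuery.uprob_mono fun π =>
          XorQuery.evenOrParallel_of_parityMatrix_mulVec_eq_zero π d).trans (by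
            have := XorQuery.uprob_evenOrParallel_le_exp hN hm hn (by omega) (XorQuery.supp d)
              (by rw [XorQuery.card_supp, hd]; exact one_pos)
            rw [XorQuery.card_supp, hd] at this
            simpa [hW] using this)) Ψ hΨ
      rw [hq]
      linarith
    · exact hzero (XorQuery.parityMatrix (c := c) (Δ := Δ))
        XorQuery.evenOrParallel_of_parityMatrix_mulVec_eq_zero
        (fun π d => XorQuery.parityMatrix_mulVec_ne_zero hodd π d)
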